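/- Let $\ell$ be a prime number, $\overline{\mathbb{Q}}$ an algebraic closure of $\mathbb{Q}$, and fix an embedding of $\overline{\mathbb{Q}}$ into an algebraic closure $\overline{\mathbb{Q}}_\ell$ of $\mathbb{Q}_\ell$. Call a number field $K\subset\overline{\mathbb{Q}}$ - *totally $\ell$-adic* if all its conjugates $K^\sigma$, $\sigma\in\mathrm{Gal}(\overline{\mathbb{Q}}/\mathbb{Q})$, are contained in $\mathbb{Q}_\ell$; - a field *with $\ell$-adic conjugation* if it has a totally $\ell$-adic subfield $F$ such that each place of $F$ above $\ell$ has exactly one place of $K$ above it; - a field *with unramified quadratic $\ell$-adic conjugation* if it is a quadratic extension of a totally $\ell$-adic subfield $F$ such that each place of $F$ above $\ell$ is inert in $K$. Then: (i) If $K$ and $K'$ are totally $\ell$-adic number fields, their compositum $KK'$ (in $\overline{\mathbb{Q}}$) is totally $\ell$-adic. (ii) There are number fields $K$ and $K'$ with $\ell$-adic conjugation such that $KK'$ is not a field with $\ell$-adic conjugation. (iii) If $K$ and $K'$ are number fields with unramified quadratic $\ell$-adic conjugation, then $KK'$ is a field with unramified quadratic $\ell$-adic conjugation. -/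

import Mathlib

open scoped NumberField

/-- `K ⊆ ℚ̄` is totally `ℓ`-adic: all its conjugates `K^σ` under `Gal(ℚ̄/ℚ)` lie in `ℚ_ℓ`, where
`ℚ̄` is regarded as a subfield of `ℚ̄_ℓ` by means of the embedding `ι`. -/
def IsTotallyAdic {ℓ : ℕ} [Fact ℓ.Prime]
    {Qbar : Type*} [Field Qbar] [CharZero Qbar] (ι : Qbar →+* AlgebraicClosure ℚ_[ℓ])
    (K : IntermediateField ℚ Qbar) : Prop :=
  ∀ σ : Qbar ≃ₐ[ℚ] Qbar, ∀ x ∈ K.map (σ : Qbar →ₐ[ℚ] Qbar),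
    ι x ∈ (algebraMap ℚ_[ℓ] (AlgebraicClosure ℚ_[ℓ])).range

/-- The places of the number field `F` above `ℓ`: the prime ideals of its ring of integers that
lie over `ℓ`. -/
def placesAbove (ℓ : ℕ) (F : Type*) [Field F] : Set (Ideal (𝓞 F)) :=
  (Ideal.span {(ℓ : ℤ)}).primesOver (𝓞 F)

/-- No place of `F` above `ℓ` splits in `K`: each one has exactly one place of `K` above it. -/
def IsNonsplitAbove (ℓ : ℕ) (F K : Type*) [Field F] [Field K] [Algebra F K] : Prop :=
  ∀ l ∈ placesAbove ℓ F, ∃! L : Ideal (𝓞 K), L ∈ l.primesOver (𝓞 K)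

/-- Each place of `F` above `ℓ` is inert in `K`: it generates a prime ideal of the ring of integers
of `K`. -/
def IsTotallyInertAbove (ℓ : ℕ) (F K : Type*) [Field F] [Field K] [Algebra F K] : Prop :=
  ∀ l ∈ placesAbove ℓ F, (l.map (algebraMap (𝓞 F) (𝓞 K))).IsPrime

/-- `K ⊆ ℚ̄` has `ℓ`-adic conjugation: `K` is non-split above `ℓ` over some totally `ℓ`-adic
subfield `F` (`IntermediateField.extendScalars h` is `K`, seen as an extension of `F`). -/
def HasAdicConjugation {ℓ : ℕ} [Fact ℓ.Prime]
    {Qbar : Type*} [Field Qbar] [CharZero Qbar] (ι : Qbar →+* AlgebraicClosure ℚ_[ℓ])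
    (K : IntermediateField ℚ Qbar) : Prop :=
  ∃ (F : IntermediateField ℚ Qbar) (h : F ≤ K),
    IsTotallyAdic ι F ∧ IsNonsplitAbove ℓ F (IntermediateField.extendScalars h)

/-- `K ⊆ ℚ̄` has unramified quadratic `ℓ`-adic conjugation: `K` is a quadratic extension, totally
inert above `ℓ`, of some totally `ℓ`-adic subfield `F`. -/
def HasUnramifiedQuadraticAdicConjugation {ℓ : ℕ} [Fact ℓ.Prime]
    {Qbar : Type*} [Field Qbar] [CharZero Qbar] (ι : Qbar →+* AlgebraicClosure ℚ_[ℓ])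
    (K : IntermediateField ℚ Qbar) : Prop :=
  ∃ (F : IntermediateField ℚ Qbar) (h : F ≤ K),
    IsTotallyAdic ι F ∧ Module.finrank F (IntermediateField.extendScalars h) = 2 ∧
      IsTotallyInertAbove ℓ F (IntermediateField.extendScalars h)

/-! Places above `ℓ` are handled through embeddings into the algebraic closure of `ℚ_ℓ`: every prime
above `ℓ` is cut out by one (`exists_adicPrime_eq`). A totally `ℓ`-adic `F` has residue fields `𝔽_ℓ`
and is unramified at `ℓ`, so over `F` a place `L` has inertia degree at least 2 once some integer of
`K` is not congruent to an element of `ℤ`, and is ramified once `ℓ ∈ L ^ 2`.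

(i) Elements with all conjugates in `ℚ_ℓ` form a field, `totallyAdicSubfield`, and being totally
`ℓ`-adic means lying inside it.

(iii) Write `K = F(δ)`, `K' = F'(δ')` with `δ²`, `δ'²` in the base fields. Under every embedding
these squares are discriminants of the unramified quadratic extension of `ℚ_ℓ`. There is only one
such extension, so `δ/δ'` is totally `ℓ`-adic (`div_mem_totallyAdicSubfield`). Then `KK'` is `E(δ)`
for `E = FF'(δ/δ')`, and it is inert over `E` because the residue extension already shows in `K`.

(ii) Choose `X² - X + n` irreducible mod `ℓ`, with root `ω`. Let `θ² - θ + ℓ = 0`, so `ℚ(θ)` is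
totally `ℓ`-adic, and let `β` be a root of `X² - (1 - θ)X + (1 - θ)n`. Over `ℚ(θ)`, `β` gives an
inert place where `θ` is small and a ramified one where `1 - θ` is small. So `ℚ(ω)` and `ℚ(θ, β)`
have `ℓ`-adic conjugation. In the compositum, the ramified place shows that `ω` and `β` are
independent over any totally `ℓ`-adic subfield containing `θ`. At the other place `ω` and `β`
generate the same local extension, which forces splitting (`not_hasAdicConjugation_sup`). -/

/-! ### Primes above `ℓ` cut out by `ℓ`-adic embeddings -/

section AdicPrime

variable {ℓ : ℕ} [Fact ℓ.Prime]

theorem PadicAlgCl.norm_le_one_of_isIntegral {x : PadicAlgCl ℓ} (hx : IsIntegral ℤ x) :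
    ‖x‖ ≤ 1 := by
  have := Valuation.Integers.mem_of_integral
    (Valuation.integer.integers (NormedField.valuation (K := PadicAlgCl ℓ)))
    (hx.tower_top (A := (NormedField.valuation (K := PadicAlgCl ℓ)).integer))
  exact this

theorem PadicAlgCl.norm_natCast_prime : ‖(ℓ : PadicAlgCl ℓ)‖ = (ℓ : ℝ)⁻¹ := by
  rw [← map_natCast (algebraMap ℚ_[ℓ] (PadicAlgCl ℓ)), PadicAlgCl.norm_extends, Padic.norm_p]

theorem PadicAlgCl.norm_natCast_prime_lt_one : ‖(ℓ : PadicAlgCl ℓ)‖ < 1 := by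
  rw [PadicAlgCl.norm_natCast_prime]
  exact inv_lt_one_of_one_lt₀ (by exact_mod_cast (Fact.out : ℓ.Prime).one_lt)

theorem PadicAlgCl.norm_add_lt_one {x y : PadicAlgCl ℓ} (hx : ‖x‖ < 1) (hy : ‖y‖ < 1) :
    ‖x + y‖ < 1 :=
  (PadicAlgCl.isNonarchimedean ℓ x y).trans_lt (max_lt hx hy)

theorem PadicAlgCl.norm_sub_lt_one {x y : PadicAlgCl ℓ} (hx : ‖x‖ < 1) (hy : ‖y‖ < 1) :
    ‖x - y‖ < 1 := by
  rw [sub_eq_add_neg]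
  exact PadicAlgCl.norm_add_lt_one hx (by rwa [norm_neg])

theorem PadicAlgCl.norm_mul_lt_one {x y : PadicAlgCl ℓ} (hx : ‖x‖ < 1) (hy : ‖y‖ ≤ 1) :
    ‖x * y‖ < 1 := by
  rw [norm_mul]
  exact mul_lt_one_of_nonneg_of_lt_one_left (norm_nonneg _) hx hy

theorem PadicAlgCl.norm_intCast_lt_one_iff (n : ℤ) : ‖(n : PadicAlgCl ℓ)‖ < 1 ↔ (ℓ : ℤ) ∣ n := by
  rw [← map_intCast (algebraMap ℚ_[ℓ] (PadicAlgCl ℓ)), PadicAlgCl.norm_extends,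
    Padic.norm_intCast_lt_one_iff]

variable {K : Type*} [Field K]

theorem norm_map_ringOfIntegers_le_one (φ : K →+* PadicAlgCl ℓ) (x : 𝓞 K) : ‖φ x‖ ≤ 1 :=
  PadicAlgCl.norm_le_one_of_isIntegral (map_isIntegral_int φ x.isIntegral_coe)

/-- The prime ideal of the ring of integers of `K` cut out by an embedding of `K` into an algebraic
closure of `ℚ_ℓ`. -/
noncomputable def adicPrime (φ : K →+* PadicAlgCl ℓ) : Ideal (𝓞 K) where
  carrier := {x | ‖φ x‖ < 1}
  add_mem' {x y} hx hy := by
    simp only [Set.mem_ofPred_eq, map_add] at *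
    exact PadicAlgCl.norm_add_lt_one hx hy
  zero_mem' := by simp
  smul_mem' c x hx := by
    simp only [Set.mem_ofPred_eq, smul_eq_mul, map_mul] at *
    rw [mul_comm]
    exact PadicAlgCl.norm_mul_lt_one hx (norm_map_ringOfIntegers_le_one φ c)

theorem mem_adicPrime {φ : K →+* PadicAlgCl ℓ} {x : 𝓞 K} : x ∈ adicPrime φ ↔ ‖φ x‖ < 1 := Iff.rfl

theorem sub_intCast_mem_adicPrime {φ : K →+* PadicAlgCl ℓ} {x : 𝓞 K} {n : ℤ} :
    x - n ∈ adicPrime φ ↔ ‖φ x - n‖ < 1 := by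
  rw [mem_adicPrime, show φ ((x - n : 𝓞 K) : K) = φ x - n by simp]

instance adicPrime_isPrime (φ : K →+* PadicAlgCl ℓ) : (adicPrime φ).IsPrime := by
  refine Ideal.isPrime_iff.2 ⟨?_, fun {x y} h ↦ ?_⟩
  · rw [Ideal.ne_top_iff_one, mem_adicPrime]
    simp
  · by_contra! hc
    simp only [mem_adicPrime, not_lt, map_mul, norm_mul] at h hc
    exact absurd h (not_lt.2 (one_le_mul_of_one_le_of_one_le hc.1 hc.2))

instance adicPrime_liesOver (φ : K →+* PadicAlgCl ℓ) :
    (adicPrime φ).LiesOver (Ideal.span {(ℓ : ℤ)}) := by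
  constructor
  ext n
  rw [Ideal.mem_span_singleton, Ideal.under_def, Ideal.mem_comap, mem_adicPrime,
    ← PadicAlgCl.norm_intCast_lt_one_iff (ℓ := ℓ)]
  simp

theorem adicPrime_mem_placesAbove (φ : K →+* PadicAlgCl ℓ) : adicPrime φ ∈ placesAbove ℓ K :=
  ⟨inferInstance, inferInstance⟩

theorem adicPrime_comap {F : Type*} [Field F] [Algebra F K] (φ : K →+* PadicAlgCl ℓ) :
    (adicPrime φ).comap (algebraMap (𝓞 F) (𝓞 K)) = adicPrime (φ.comp (algebraMap F K)) := rfl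

/-- In the normal closure the Galois group permutes the primes above `ℓ` transitively, so twisting
one embedding by automorphisms reaches them all. -/
theorem exists_adicPrime_eq [NumberField K] {l : Ideal (𝓞 K)} (hl : l ∈ placesAbove ℓ K) :
    ∃ φ : K →+* PadicAlgCl ℓ, adicPrime φ = l := by
  obtain ⟨_, _⟩ := hl
  have : Algebra.IsAlgebraic ℚ (AlgebraicClosure K) := Algebra.IsAlgebraic.trans ℚ K _
  have : IsAlgClosure ℚ (AlgebraicClosure K) := ⟨inferInstance, inferInstance⟩
  have : Normal ℚ (AlgebraicClosure K) := IsAlgClosure.normal ℚ _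
  have : IsGalois ℚ (AlgebraicClosure K) := { }
  let N := IntermediateField.normalClosure ℚ K (AlgebraicClosure K)
  have : NumberField N := { to_finiteDimensional := normalClosure.is_finiteDimensional ℚ K _ }
  have : IsGalois ℚ N := IsGalois.normalClosure ℚ K _
  obtain ⟨⟨Q, hQ, hQl⟩⟩ : Nonempty (l.primesOver (𝓞 N)) := inferInstance
  have : IsScalarTower ℤ (𝓞 K) (𝓞 N) := IsScalarTower.of_algebraMap_eq' (Subsingleton.elim _ _)
  have : Q.LiesOver (Ideal.span {(ℓ : ℤ)}) := Ideal.LiesOver.trans Q l _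
  let ψ : N →+* PadicAlgCl ℓ := (IsAlgClosed.lift : N →ₐ[ℚ] PadicAlgCl ℓ).toRingHom
  obtain ⟨σ, hσ⟩ := Ideal.exists_smul_eq_of_isGaloisGroup (Ideal.span {(ℓ : ℤ)})
    Q (adicPrime ψ) Gal(N/ℚ)
  refine ⟨(ψ.comp (σ : N →+* N)).comp (algebraMap K N), ?_⟩
  rw [← adicPrime_comap, Ideal.over_def Q l, Ideal.under_def]
  congr 1
  ext x
  rw [← Ideal.smul_mem_pointwise_smul_iff (a := σ) (S := Q), hσ]
  rfl

theorem PadicAlgCl.exists_intCast_norm_sub_lt_one {x : ℚ_[ℓ]} (hx : ‖x‖ ≤ 1) :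
    ∃ n : ℤ, ‖algebraMap ℚ_[ℓ] (PadicAlgCl ℓ) x - n‖ < 1 := by
  obtain ⟨n, -, hn⟩ := PadicInt.exists_mem_range (⟨x, hx⟩ : ℤ_[ℓ])
  refine ⟨n, ?_⟩
  rw [← map_intCast (algebraMap ℚ_[ℓ] (PadicAlgCl ℓ)), ← map_sub, PadicAlgCl.norm_extends]
  rw [PadicInt.maximalIdeal_eq_span_p, Ideal.mem_span_singleton, ← PadicInt.norm_lt_one_iff_dvd,
    PadicInt.norm_def] at hn
  exact_mod_cast hn

/-- Every embedding of `F` into an algebraic closure of `ℚ_ℓ` has its image in `ℚ_ℓ`. -/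
def AllEmbeddingsAdic (ℓ : ℕ) [Fact ℓ.Prime] (F : Type*) [Field F] : Prop :=
  ∀ (φ : F →+* PadicAlgCl ℓ) (x : F), φ x ∈ (algebraMap ℚ_[ℓ] (PadicAlgCl ℓ)).range

/-- The residue field is that of `ℤ_ℓ`, in which `ℤ` is dense. -/
theorem AllEmbeddingsAdic.exists_intCast (h : AllEmbeddingsAdic ℓ K) (φ : K →+* PadicAlgCl ℓ)
    (x : 𝓞 K) : ∃ n : ℤ, x - n ∈ adicPrime φ := by
  obtain ⟨z, hz⟩ := h φ x
  have hz' : ‖z‖ ≤ 1 := by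
    rw [← PadicAlgCl.norm_extends, hz]
    exact norm_map_ringOfIntegers_le_one φ x
  obtain ⟨n, hn⟩ := PadicAlgCl.exists_intCast_norm_sub_lt_one hz'
  refine ⟨n, ?_⟩
  rw [mem_adicPrime]
  simpa [hz] using hn

theorem AllEmbeddingsAdic.norm_le_of_mem_adicPrime (h : AllEmbeddingsAdic ℓ K)
    {φ : K →+* PadicAlgCl ℓ} {x : 𝓞 K} (hx : x ∈ adicPrime φ) : ‖φ x‖ ≤ (ℓ : ℝ)⁻¹ := by
  obtain ⟨z, hz⟩ := h φ x
  rw [mem_adicPrime, ← hz, PadicAlgCl.norm_extends] at hx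
  rw [← hz, PadicAlgCl.norm_extends]
  have := (Padic.norm_le_pow_iff_norm_lt_pow_add_one z (-1)).2 (by simpa using hx)
  simpa using this

/-- The values of `ℚ_ℓ` are powers of `ℓ`, so elements of the prime have norm at most `ℓ⁻¹` and
those of its square at most `ℓ⁻²`: `ℓ` is unramified. -/
theorem AllEmbeddingsAdic.natCast_notMem_adicPrime_sq (h : AllEmbeddingsAdic ℓ K)
    (φ : K →+* PadicAlgCl ℓ) : (ℓ : 𝓞 K) ∉ adicPrime φ ^ 2 := by
  have hℓ : (0 : ℝ) < (ℓ : ℝ)⁻¹ := by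
    have := (Fact.out : ℓ.Prime).pos
    positivity
  have key : ∀ x ∈ adicPrime φ * adicPrime φ, ‖φ (x : K)‖ ≤ (ℓ : ℝ)⁻¹ * (ℓ : ℝ)⁻¹ := by
    intro x hx
    refine Submodule.mul_induction_on hx (fun m hm n hn ↦ ?_) fun x y hx hy ↦ ?_
    · rw [show φ ((m * n : 𝓞 K) : K) = φ m * φ n by simp, norm_mul]
      exact mul_le_mul (h.norm_le_of_mem_adicPrime hm) (h.norm_le_of_mem_adicPrime hn)
        (norm_nonneg _) hℓ.le
    · rw [show φ ((x + y : 𝓞 K) : K) = φ x + φ y by simp]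
      exact (PadicAlgCl.isNonarchimedean ℓ _ _).trans (max_le hx hy)
  intro hmem
  have := key _ (by rwa [← pow_two])
  rw [show φ ((ℓ : 𝓞 K) : K) = (ℓ : PadicAlgCl ℓ) by simp, PadicAlgCl.norm_natCast_prime] at this
  have h1 : (ℓ : ℝ)⁻¹ < 1 := inv_lt_one_of_one_lt₀ (by exact_mod_cast (Fact.out : ℓ.Prime).one_lt)
  nlinarith

end AdicPrime

/-! ### Inertia and ramification over a totally `ℓ`-adic base -/

theorem Ideal.inertiaDeg_eq_one_iff {R S : Type*} [CommRing R] [CommRing S] [Algebra R S]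
    (p : Ideal R) (q : Ideal S) [p.IsMaximal] [q.IsMaximal] [q.LiesOver p] :
    q.inertiaDeg R = 1 ↔ ∀ a : S, ∃ r : R, a - algebraMap R S r ∈ q := by
  let := Ideal.Quotient.field p
  rw [Ideal.inertiaDeg_eq_of_isMaximal p q, finrank_eq_one_iff_of_nonzero' (1 : S ⧸ q) one_ne_zero]
  refine ⟨fun h a ↦ ?_, fun h w ↦ ?_⟩
  · obtain ⟨c, hc⟩ := h (Ideal.Quotient.mk q a)
    obtain ⟨r, rfl⟩ := Ideal.Quotient.mk_surjective c
    refine ⟨r, ?_⟩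
    rw [← Ideal.Quotient.eq, ← hc, Algebra.smul_def, mul_one]
    rfl
  · obtain ⟨a, rfl⟩ := Ideal.Quotient.mk_surjective w
    obtain ⟨r, hr⟩ := h a
    refine ⟨Ideal.Quotient.mk p r, ?_⟩
    rw [Ideal.Quotient.eq.2 hr, Algebra.smul_def, mul_one]
    rfl

theorem mem_placesAbove_of_liesOver {ℓ : ℕ} {F K : Type*} [Field F] [Field K] [Algebra F K]
    {l : Ideal (𝓞 F)} (hl : l ∈ placesAbove ℓ F)
    {L : Ideal (𝓞 K)} (hL : L ∈ l.primesOver (𝓞 K)) : L ∈ placesAbove ℓ K := by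
  have := hl.2
  have := hL.2
  have : IsScalarTower ℤ (𝓞 F) (𝓞 K) := IsScalarTower.of_algebraMap_eq' (Subsingleton.elim _ _)
  exact ⟨hL.1, Ideal.LiesOver.trans L l _⟩

theorem sum_ramification_inertia_placesAbove {ℓ : ℕ} {F K : Type*} [Field F] [Field K]
    [NumberField F] [NumberField K] [Algebra F K] {l : Ideal (𝓞 F)} (hl : l ∈ placesAbove ℓ F)
    [Fintype (l.primesOver (𝓞 K))] :
    ∑ L : l.primesOver (𝓞 K), L.1.ramificationIdx (𝓞 F) * L.1.inertiaDeg (𝓞 F) =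
      Module.finrank F K := by
  have := hl.1
  rw [Ideal.sum_ramification_inertia_eq_finrank, IsFractionRing.finrank_eq (𝓞 F) F (𝓞 K) K]

section

variable {ℓ : ℕ} [Fact ℓ.Prime]

theorem ne_bot_of_mem_placesAbove {F : Type*} [Field F] [NumberField F] {l : Ideal (𝓞 F)}
    (hl : l ∈ placesAbove ℓ F) : l ≠ ⊥ :=
  Ideal.ne_bot_of_mem_primesOver (by simpa using (Fact.out : ℓ.Prime).ne_zero) hl

theorem isMaximal_of_mem_placesAbove {F : Type*} [Field F] [NumberField F] {l : Ideal (𝓞 F)}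
    (hl : l ∈ placesAbove ℓ F) : l.IsMaximal :=
  hl.1.isMaximal (ne_bot_of_mem_placesAbove hl)

variable {F K : Type*} [Field F] [Field K] [NumberField F] [NumberField K] [Algebra F K]

theorem AllEmbeddingsAdic.inertiaDeg_eq_one_iff (hF : AllEmbeddingsAdic ℓ F) {l : Ideal (𝓞 F)}
    (hl : l ∈ placesAbove ℓ F) {L : Ideal (𝓞 K)} (hL : L ∈ l.primesOver (𝓞 K)) :
    L.inertiaDeg (𝓞 F) = 1 ↔ ∀ a : 𝓞 K, ∃ n : ℤ, a - n ∈ L := by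
  have := isMaximal_of_mem_placesAbove hl
  have := isMaximal_of_mem_placesAbove (mem_placesAbove_of_liesOver hl hL)
  have := hL.2
  obtain ⟨φ, rfl⟩ := exists_adicPrime_eq hl
  rw [Ideal.inertiaDeg_eq_one_iff (adicPrime φ) L]
  refine forall_congr' fun a ↦ ⟨fun ⟨r, hr⟩ ↦ ?_, fun ⟨n, hn⟩ ↦ ⟨n, by simpa using hn⟩⟩
  obtain ⟨n, hn⟩ := hF.exists_intCast φ r
  refine ⟨n, ?_⟩
  rw [Ideal.mem_of_liesOver L (adicPrime φ)] at hn
  simpa using add_mem hr hn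

theorem two_le_ramificationIdx_of_map_le {l : Ideal (𝓞 F)} (hl : l ∈ placesAbove ℓ F)
    {L : Ideal (𝓞 K)} (hL : L ∈ l.primesOver (𝓞 K))
    (h : l.map (algebraMap (𝓞 F) (𝓞 K)) ≤ L ^ 2) : 2 ≤ L.ramificationIdx (𝓞 F) := by
  have := hL.1
  have := hL.2
  have hl0 : l.map (algebraMap (𝓞 F) (𝓞 K)) ≠ ⊥ :=
    Ideal.map_ne_bot_of_ne_bot (ne_bot_of_mem_placesAbove hl)
  rw [Ideal.IsDedekindDomain.ramificationIdx_eq_multiplicity l L hl0]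
  refine FiniteMultiplicity.le_multiplicity_of_pow_dvd ?_ (Ideal.dvd_iff_le.2 h)
  refine FiniteMultiplicity.of_not_isUnit ?_ hl0
  rw [Ideal.isUnit_iff]
  exact hL.1.ne_top

theorem AllEmbeddingsAdic.two_le_ramificationIdx (hF : AllEmbeddingsAdic ℓ F) {l : Ideal (𝓞 F)}
    (hl : l ∈ placesAbove ℓ F) {L : Ideal (𝓞 K)} (hL : L ∈ l.primesOver (𝓞 K))
    (h : (ℓ : 𝓞 K) ∈ L ^ 2) : 2 ≤ L.ramificationIdx (𝓞 F) := by
  have := hL.2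
  have hl0 := ne_bot_of_mem_placesAbove hl
  have := isMaximal_of_mem_placesAbove hl
  refine two_le_ramificationIdx_of_map_le hl hL ?_
  obtain ⟨φ, rfl⟩ := exists_adicPrime_eq hl
  -- Since `ℓ` is a uniformizer, it generates the prime modulo its square. The left side divides the
  -- square of the prime, so it is one of three powers, and two are excluded.
  have hspan : Ideal.span {(ℓ : 𝓞 F)} ⊔ adicPrime φ ^ 2 = adicPrime φ := by
    have hle : Ideal.span {(ℓ : 𝓞 F)} ⊔ adicPrime φ ^ 2 ≤ adicPrime φ :=
      sup_le ((Ideal.span_singleton_le_iff_mem _).2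
        (by rw [mem_adicPrime]; simpa using PadicAlgCl.norm_natCast_prime_lt_one))
        (Ideal.pow_le_self two_ne_zero)
    have hp : Prime (adicPrime φ) := Ideal.prime_of_isPrime hl0 inferInstance
    obtain ⟨i, hi, hJ⟩ := (dvd_prime_pow hp 2).1
      (Ideal.dvd_iff_le.2 (le_sup_right : _ ≤ Ideal.span {(ℓ : 𝓞 F)} ⊔ adicPrime φ ^ 2))
    rw [associated_iff_eq] at hJ
    interval_cases i
    · rw [hJ, pow_zero, Ideal.one_eq_top, top_le_iff] at hle
      exact absurd hle (adicPrime_isPrime φ).ne_top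
    · rw [hJ, pow_one]
    · exact absurd ((Ideal.span_singleton_le_iff_mem _).1 (le_sup_left.trans hJ.le))
        (hF.natCast_notMem_adicPrime_sq φ)
  rw [← hspan, Ideal.map_sup, Ideal.map_pow, Ideal.map_span, Set.image_singleton, map_natCast]
  refine sup_le ((Ideal.span_singleton_le_iff_mem _).2 h) (Ideal.pow_right_mono ?_ 2)
  exact Ideal.map_le_iff_le_comap.2 (Ideal.over_def L (adicPrime φ)).le

end

/-! ### Non-split and inert places in quadratic extensions -/

section

variable {ℓ : ℕ} [Fact ℓ.Prime]
variable {F K : Type*} [Field F] [Field K] [NumberField F] [NumberField K] [Algebra F K]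

theorem ramificationIdx_mul_inertiaDeg_le_finrank {l : Ideal (𝓞 F)} (hl : l ∈ placesAbove ℓ F)
    {L : Ideal (𝓞 K)} (hL : L ∈ l.primesOver (𝓞 K)) :
    L.ramificationIdx (𝓞 F) * L.inertiaDeg (𝓞 F) ≤ Module.finrank F K := by
  have := isMaximal_of_mem_placesAbove hl
  rw [← sum_ramification_inertia_placesAbove hl]
  exact Finset.single_le_sum (f := fun L : l.primesOver (𝓞 K) ↦
    L.1.ramificationIdx (𝓞 F) * L.1.inertiaDeg (𝓞 F)) (fun _ _ ↦ zero_le) (Finset.mem_univ ⟨L, hL⟩)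

theorem ramificationIdx_mul_inertiaDeg_eq_finrank {l : Ideal (𝓞 F)} (hl : l ∈ placesAbove ℓ F)
    {L : Ideal (𝓞 K)} (hL : L ∈ l.primesOver (𝓞 K)) (h : ∀ L' ∈ l.primesOver (𝓞 K), L' = L) :
    L.ramificationIdx (𝓞 F) * L.inertiaDeg (𝓞 F) = Module.finrank F K := by
  have := isMaximal_of_mem_placesAbove hl
  rw [← sum_ramification_inertia_placesAbove hl]
  exact (Fintype.sum_eq_single (f := fun L : l.primesOver (𝓞 K) ↦
    L.1.ramificationIdx (𝓞 F) * L.1.inertiaDeg (𝓞 F)) ⟨L, hL⟩ fun L' hL' ↦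
    absurd (Subtype.ext (h L' L'.2)) hL').symm

theorem add_ramificationIdx_mul_inertiaDeg_le_finrank {l : Ideal (𝓞 F)} (hl : l ∈ placesAbove ℓ F)
    {L L' : Ideal (𝓞 K)} (hL : L ∈ l.primesOver (𝓞 K)) (hL' : L' ∈ l.primesOver (𝓞 K))
    (hne : L ≠ L') :
    L.ramificationIdx (𝓞 F) * L.inertiaDeg (𝓞 F) + L'.ramificationIdx (𝓞 F) * L'.inertiaDeg (𝓞 F)
      ≤ Module.finrank F K := by
  have := isMaximal_of_mem_placesAbove hl
  rw [← sum_ramification_inertia_placesAbove hl]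
  exact Finset.add_le_sum (f := fun L : l.primesOver (𝓞 K) ↦
    L.1.ramificationIdx (𝓞 F) * L.1.inertiaDeg (𝓞 F)) (fun _ _ ↦ zero_le)
    (Finset.mem_univ ⟨L, hL⟩) (Finset.mem_univ ⟨L', hL'⟩) (by simpa using hne)

theorem ramificationIdx_pos_of_mem_primesOver {l : Ideal (𝓞 F)}
    {L : Ideal (𝓞 K)} (hL : L ∈ l.primesOver (𝓞 K)) : 0 < L.ramificationIdx (𝓞 F) := by
  have := hL.1
  exact Ideal.ramificationIdx_pos L (𝓞 F)

theorem inertiaDeg_pos_of_mem_primesOver {l : Ideal (𝓞 F)}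
    {L : Ideal (𝓞 K)} (hL : L ∈ l.primesOver (𝓞 K)) : 0 < L.inertiaDeg (𝓞 F) := by
  have := hL.1
  exact Ideal.inertiaDeg_pos L (𝓞 F)

theorem adicPrime_mem_primesOver {F K : Type*} [Field F] [Field K] [Algebra F K]
    (φ : K →+* PadicAlgCl ℓ) :
    adicPrime φ ∈ (adicPrime (φ.comp (algebraMap F K))).primesOver (𝓞 K) :=
  ⟨inferInstance, ⟨(adicPrime_comap φ).symm⟩⟩

theorem AllEmbeddingsAdic.two_le_inertiaDeg (hF : AllEmbeddingsAdic ℓ F) {l : Ideal (𝓞 F)}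
    (hl : l ∈ placesAbove ℓ F) {L : Ideal (𝓞 K)} (hL : L ∈ l.primesOver (𝓞 K))
    (h : ∃ a : 𝓞 K, ∀ n : ℤ, a - n ∉ L) : 2 ≤ L.inertiaDeg (𝓞 F) := by
  have h1 := inertiaDeg_pos_of_mem_primesOver hL
  have h2 : L.inertiaDeg (𝓞 F) ≠ 1 := by
    rw [Ne, hF.inertiaDeg_eq_one_iff hl hL]
    push Not
    exact h
  omega

/-- Over a field all of whose embeddings are `ℓ`-adic, an extension of degree at most two is
non-split above `ℓ` as soon as each of its places is ramified or has a nontrivial residue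
extension. -/
theorem AllEmbeddingsAdic.isNonsplitAbove (hF : AllEmbeddingsAdic ℓ F)
    (hfin : Module.finrank F K ≤ 2)
    (h : ∀ L ∈ placesAbove ℓ K, (∃ a : 𝓞 K, ∀ n : ℤ, a - n ∉ L) ∨ (ℓ : 𝓞 K) ∈ L ^ 2) :
    IsNonsplitAbove ℓ F K := by
  intro l hl
  have hl1 := hl.1
  -- Two distinct places would contribute at least 4 to a sum of local degrees that is at most 2.
  have key : ∀ L ∈ l.primesOver (𝓞 K), 2 ≤ L.ramificationIdx (𝓞 F) * L.inertiaDeg (𝓞 F) := by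
    intro L hL
    have h1 := ramificationIdx_pos_of_mem_primesOver hL
    have h2 := inertiaDeg_pos_of_mem_primesOver hL
    rcases h L (mem_placesAbove_of_liesOver hl hL) with ha | ha
    · nlinarith [hF.two_le_inertiaDeg hl hL ha]
    · nlinarith [hF.two_le_ramificationIdx hl hL ha]
  obtain ⟨⟨L, hL⟩⟩ : Nonempty (l.primesOver (𝓞 K)) := inferInstance
  refine ⟨L, hL, fun L' hL' ↦ ?_⟩
  by_contra hne
  have := add_ramificationIdx_mul_inertiaDeg_le_finrank hl hL' hL hne
  have := key L hL
  have := key L' hL'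
  omega

theorem AllEmbeddingsAdic.four_le_finrank (hF : AllEmbeddingsAdic ℓ F)
    (φ : K →+* PadicAlgCl ℓ) (h1 : ∃ a : 𝓞 K, ∀ n : ℤ, a - n ∉ adicPrime φ)
    (h2 : (ℓ : 𝓞 K) ∈ adicPrime φ ^ 2) : 4 ≤ Module.finrank F K := by
  have hl := adicPrime_mem_placesAbove (φ.comp (algebraMap F K))
  have hL := adicPrime_mem_primesOver (F := F) φ
  have := ramificationIdx_mul_inertiaDeg_le_finrank hl hL
  nlinarith [hF.two_le_inertiaDeg hl hL h1, hF.two_le_ramificationIdx hl hL h2]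

theorem AllEmbeddingsAdic.isTotallyInertAbove (hF : AllEmbeddingsAdic ℓ F)
    (hfin : Module.finrank F K = 2)
    (h : ∀ φ : K →+* PadicAlgCl ℓ, ∃ a : 𝓞 K, ∀ n : ℤ, a - n ∉ adicPrime φ) :
    IsTotallyInertAbove ℓ F K := by
  intro l hl
  have := hl.1
  obtain ⟨⟨L, hL⟩⟩ : Nonempty (l.primesOver (𝓞 K)) := inferInstance
  have key : ∀ L ∈ l.primesOver (𝓞 K), 2 ≤ L.inertiaDeg (𝓞 F) := by
    intro L hL
    obtain ⟨φ, rfl⟩ := exists_adicPrime_eq (mem_placesAbove_of_liesOver hl hL)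
    exact hF.two_le_inertiaDeg hl hL (h φ)
  have hunique : ∀ L' ∈ l.primesOver (𝓞 K), L' = L := by
    intro L' hL'
    by_contra hne
    have := add_ramificationIdx_mul_inertiaDeg_le_finrank hl hL' hL hne
    nlinarith [key L hL, key L' hL', ramificationIdx_pos_of_mem_primesOver hL,
      ramificationIdx_pos_of_mem_primesOver hL']
  have hef := ramificationIdx_mul_inertiaDeg_eq_finrank hl hL hunique
  have he : L.ramificationIdx (𝓞 F) = 1 := by
    have h1 := key L hL
    have h2 := ramificationIdx_pos_of_mem_primesOver hL
    nlinarith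
  have := isMaximal_of_mem_placesAbove hl
  have hset : (l.primesOver (𝓞 K)).toFinset = {L} := by
    ext L'
    simpa using ⟨hunique L', fun h ↦ h ▸ hL⟩
  rw [Ideal.map_algebraMap_eq_finsetProd_pow (ne_bot_of_mem_placesAbove hl), hset,
    Finset.prod_singleton, he, pow_one]
  exact hL.1

/-- Inertness leaves one place with `e = 1`, hence `f = 2`, and the residue extension is nontrivial.
-/
theorem AllEmbeddingsAdic.exists_sub_intCast_notMem (hF : AllEmbeddingsAdic ℓ F)
    (hfin : Module.finrank F K = 2) (h : IsTotallyInertAbove ℓ F K) (φ : K →+* PadicAlgCl ℓ) :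
    ∃ a : 𝓞 K, ∀ n : ℤ, a - n ∉ adicPrime φ := by
  have hl := adicPrime_mem_placesAbove (φ.comp (algebraMap F K))
  have hL := adicPrime_mem_primesOver (F := F) φ
  have hl0 : (adicPrime (φ.comp (algebraMap F K))).map (algebraMap (𝓞 F) (𝓞 K)) ≠ ⊥ :=
    Ideal.map_ne_bot_of_ne_bot (ne_bot_of_mem_placesAbove hl)
  have hmax := (h _ hl).isMaximal hl0
  have heq : ∀ L' ∈ (adicPrime (φ.comp (algebraMap F K))).primesOver (𝓞 K),
      (adicPrime (φ.comp (algebraMap F K))).map (algebraMap (𝓞 F) (𝓞 K)) = L' := fun L' hL' ↦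
    hmax.eq_of_le hL'.1.ne_top (Ideal.map_le_iff_le_comap.2 hL'.2.over.le)
  have hef := ramificationIdx_mul_inertiaDeg_eq_finrank hl hL
    fun L' hL' ↦ (heq L' hL').symm.trans (heq _ hL)
  have := hL.2
  rw [Ideal.IsDedekindDomain.ramificationIdx_eq_multiplicity _ _ hl0, heq _ hL,
    multiplicity_self, one_mul, hfin] at hef
  by_contra! hc
  rw [(hF.inertiaDeg_eq_one_iff hl hL).2 hc] at hef
  omega

end

/-! ### The unramified quadratic extension of `ℚ_ℓ` -/

section

variable {ℓ : ℕ} [Fact ℓ.Prime]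

/-- Up to squares, `d` is the discriminant of a monic quadratic polynomial over `ℤ_ℓ` that is
irreducible modulo `ℓ`. -/
def IsUnramifiedDiscriminant (d : ℚ_[ℓ]) : Prop :=
  ∃ (s : ℚ_[ℓ]) (t n : ℤ_[ℓ]), s ≠ 0 ∧ d = s ^ 2 * ((t ^ 2 - 4 * n : ℤ_[ℓ]) : ℚ_[ℓ]) ∧
    ∀ r : ℤ_[ℓ], ¬ ‖r ^ 2 - t * r + n‖ < 1

theorem IsUnramifiedDiscriminant.not_isSquare {d : ℚ_[ℓ]} (hd : IsUnramifiedDiscriminant d) :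
    ¬ IsSquare d := by
  rintro ⟨u, rfl⟩
  obtain ⟨s, t, n, hs, hd, hr⟩ := hd
  -- the root `(t + u / s) / 2`
  have hroot : ((t + u / s) / 2) ^ 2 - t * ((t + u / s) / 2) + n = 0 := by
    rw [show ((t ^ 2 - 4 * n : ℤ_[ℓ]) : ℚ_[ℓ]) = t ^ 2 - 4 * n by norm_cast] at hd
    field_simp
    linear_combination hd
  have hint : IsIntegral ℤ_[ℓ] ((t + u / s) / 2) := by
    refine ⟨.X ^ 2 - .C t * .X + .C n, by monicity!, ?_⟩
    simpa [Polynomial.eval₂_sub, Polynomial.eval₂_mul] using! hroot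
  obtain ⟨r, hr'⟩ := IsIntegrallyClosed.isIntegral_iff.1 hint
  refine hr r ?_
  have : r ^ 2 - t * r + n = 0 := by
    rw [← hr'] at hroot
    change (r : ℚ_[ℓ]) ^ 2 - t * (r : ℚ_[ℓ]) + n = 0 at hroot
    exact PadicInt.ext (by push_cast; exact hroot)
  simp [this]

theorem PadicInt.isSquare_of_norm_sq_sub_lt {a w : ℤ_[ℓ]} (h : ‖w ^ 2 - a‖ < ‖2 * w‖ ^ 2) :
    IsSquare a := by
  obtain ⟨z, hz, -⟩ := hensels_lemma (p := ℓ) (R := ℤ_[ℓ]) (F := (.X ^ 2 - .C a)) (a := w)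
    (by simpa [one_add_one_eq_two, Polynomial.derivative_X_pow] using h)
  refine ⟨z, ?_⟩
  simp at hz
  linear_combination -hz

theorem PadicInt.toZMod_eq_zero_iff (x : ℤ_[ℓ]) : PadicInt.toZMod x = 0 ↔ ‖x‖ < 1 := by
  rw [← RingHom.mem_ker, PadicInt.ker_toZMod, PadicInt.maximalIdeal_eq_span_p,
    Ideal.mem_span_singleton, PadicInt.norm_lt_one_iff_dvd]

theorem PadicInt.toZMod_surjective : Function.Surjective (PadicInt.toZMod (p := ℓ)) := fun x ↦
  ⟨(x.val : ℤ_[ℓ]), by simp⟩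

theorem PadicInt.norm_two_of_ne (h : ℓ ≠ 2) : ‖(2 : ℤ_[ℓ])‖ = 1 := by
  have h2 : ¬ ‖((2 : ℤ) : ℤ_[ℓ])‖ < 1 := by
    rw [PadicInt.norm_intCast_lt_one_iff]
    intro hd
    exact h ((Nat.prime_dvd_prime_iff_eq Fact.out Nat.prime_two).1 (by exact_mod_cast hd))
  exact le_antisymm (PadicInt.norm_le_one _) (by simpa using h2)

/-- A square root `u` of the discriminant mod `ℓ` would give the root `(t + u) / 2`. -/
theorem not_isSquare_toZMod_discriminant (hℓ : ℓ ≠ 2) {t n : ℤ_[ℓ]}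
    (h : ∀ r : ℤ_[ℓ], ¬ ‖r ^ 2 - t * r + n‖ < 1) :
    ¬ IsSquare (PadicInt.toZMod (t ^ 2 - 4 * n)) := by
  rintro ⟨u, hu⟩
  have h2 : (2 : ZMod ℓ) ≠ 0 := by
    have := fact_iff.2 (Fact.out : ℓ.Prime)
    exact Ring.two_ne_zero (by rwa [ZMod.ringChar_zmod_n])
  obtain ⟨r, hr⟩ := PadicInt.toZMod_surjective ((PadicInt.toZMod t + u) / 2)
  refine h r ((PadicInt.toZMod_eq_zero_iff _).1 ?_)
  simp only [map_add, map_sub, map_mul, map_pow, hr, map_ofNat] at hu ⊢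
  field_simp
  linear_combination -hu

theorem FiniteField.isSquare_mul_of_not_isSquare {k : Type*} [Field k] [Fintype k] {a b : k}
    (ha : ¬ IsSquare a) (hb : ¬ IsSquare b) : IsSquare (a * b) := by
  classical
  have ha0 : a ≠ 0 := fun h ↦ ha (h ▸ IsSquare.zero)
  have hb0 : b ≠ 0 := fun h ↦ hb (h ▸ IsSquare.zero)
  rw [← quadraticChar_one_iff_isSquare (mul_ne_zero ha0 hb0), map_mul,
    quadraticChar_neg_one_iff_not_isSquare.2 ha, quadraticChar_neg_one_iff_not_isSquare.2 hb]
  norm_num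

theorem PadicInt.two_dvd_or_two_dvd_sub_one (x : ℤ_[2]) : (2 : ℤ_[2]) ∣ x ∨ (2 : ℤ_[2]) ∣ x - 1 := by
  obtain ⟨n, hn, hx⟩ := PadicInt.exists_mem_range x
  rw [PadicInt.maximalIdeal_eq_span_p, Ideal.mem_span_singleton] at hx
  interval_cases n
  · exact Or.inl (by simpa using hx)
  · exact Or.inr (by simpa using hx)

/-- Testing `r = 0` and `r = 1` shows that `n` and `t` are odd; an odd square is 1 mod 8, so the
discriminant is 5 mod 8. -/
theorem exists_discriminant_eq {t n : ℤ_[2]} (h : ∀ r : ℤ_[2], ¬ ‖r ^ 2 - t * r + n‖ < 1) :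
    ∃ k : ℤ_[2], t ^ 2 - 4 * n = 8 * k - 3 := by
  simp only [PadicInt.norm_lt_one_iff_dvd, Nat.cast_ofNat] at h
  have h0 : ¬ (2 : ℤ_[2]) ∣ n := by simpa using h 0
  obtain ⟨b, hb⟩ := (PadicInt.two_dvd_or_two_dvd_sub_one n).resolve_left h0
  have h1 : ¬ (2 : ℤ_[2]) ∣ t := fun ⟨c, hc⟩ ↦ h 1 ⟨1 + b - c, by linear_combination hb - hc⟩
  obtain ⟨a, ha⟩ := (PadicInt.two_dvd_or_two_dvd_sub_one t).resolve_left h1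
  obtain ⟨c, hc⟩ : (2 : ℤ_[2]) ∣ a * (a + 1) := by
    rcases PadicInt.two_dvd_or_two_dvd_sub_one a with ⟨c, hc⟩ | ⟨c, hc⟩
    · exact ⟨c * (a + 1), by linear_combination (a + 1) * hc⟩
    · exact ⟨a * (c + 1), by linear_combination a * hc⟩
  refine ⟨c - b, ?_⟩
  linear_combination (t + 1 + 2 * a) * ha + 4 * hc - 4 * hb

/-- This is the uniqueness of the unramified quadratic extension. For odd `ℓ` two nonsquares of
`𝔽_ℓ` have a square product, which Hensel lifts; for `ℓ = 2` the product is 1 mod 8. -/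
theorem isSquare_mul_discriminant {t n t' n' : ℤ_[ℓ]}
    (h : ∀ r : ℤ_[ℓ], ¬ ‖r ^ 2 - t * r + n‖ < 1) (h' : ∀ r : ℤ_[ℓ], ¬ ‖r ^ 2 - t' * r + n'‖ < 1) :
    IsSquare ((t ^ 2 - 4 * n) * (t' ^ 2 - 4 * n')) := by
  by_cases hℓ : ℓ = 2
  · subst hℓ
    obtain ⟨k, hk⟩ := exists_discriminant_eq h
    obtain ⟨k', hk'⟩ := exists_discriminant_eq h'
    refine PadicInt.isSquare_of_norm_sq_sub_lt (w := 1) ?_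
    have h8 : ‖(2 : ℤ_[2])‖ = 2⁻¹ := by simpa using PadicInt.norm_p (p := 2)
    rw [hk, hk', show (1 : ℤ_[2]) ^ 2 - (8 * k - 3) * (8 * k' - 3) =
      2 ^ 3 * (3 * k + 3 * k' - 8 * k * k' - 1) by ring, norm_mul, norm_pow, h8, mul_one, h8]
    have := PadicInt.norm_le_one (3 * k + 3 * k' - 8 * k * k' - 1)
    linarith
  · have h1 := not_isSquare_toZMod_discriminant hℓ h
    have h2 := not_isSquare_toZMod_discriminant hℓ h'
    have h3 : IsSquare (PadicInt.toZMod ((t ^ 2 - 4 * n) * (t' ^ 2 - 4 * n'))) := by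
      rw [map_mul]
      exact FiniteField.isSquare_mul_of_not_isSquare h1 h2
    obtain ⟨v, hv⟩ := h3
    obtain ⟨w, rfl⟩ := PadicInt.toZMod_surjective v
    have hw : ‖w‖ = 1 := by
      refine le_antisymm (PadicInt.norm_le_one _) (not_lt.1 fun hw ↦ ?_)
      rw [(PadicInt.toZMod_eq_zero_iff w).2 hw, mul_zero, map_mul, mul_eq_zero] at hv
      rcases hv with hv | hv
      · exact h1 (hv ▸ IsSquare.zero)
      · exact h2 (hv ▸ IsSquare.zero)
    refine PadicInt.isSquare_of_norm_sq_sub_lt (w := w) ?_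
    rw [norm_mul, PadicInt.norm_two_of_ne hℓ, hw, one_mul, one_pow, ← PadicInt.toZMod_eq_zero_iff,
      map_sub, hv, map_pow, pow_two, sub_self]

theorem IsUnramifiedDiscriminant.isSquare_mul {d d' : ℚ_[ℓ]} (hd : IsUnramifiedDiscriminant d)
    (hd' : IsUnramifiedDiscriminant d') : IsSquare (d * d') := by
  obtain ⟨s, t, n, hs, rfl, hr⟩ := hd
  obtain ⟨s', t', n', hs', rfl, hr'⟩ := hd'
  obtain ⟨u, hu⟩ := isSquare_mul_discriminant hr hr'
  refine ⟨s * s' * u, ?_⟩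
  have : ((t ^ 2 - 4 * n : ℤ_[ℓ]) : ℚ_[ℓ]) * ((t' ^ 2 - 4 * n' : ℤ_[ℓ]) : ℚ_[ℓ]) = u * u := by
    exact_mod_cast congrArg (fun x : ℤ_[ℓ] ↦ (x : ℚ_[ℓ])) hu
  linear_combination s ^ 2 * s' ^ 2 * this

theorem IsUnramifiedDiscriminant.ne_zero {d : ℚ_[ℓ]} (hd : IsUnramifiedDiscriminant d) : d ≠ 0 := by
  rintro rfl
  exact hd.not_isSquare (IsSquare.zero)

end

/-! ### Generators of quadratic extensions -/

section

variable {F K : Type*} [Field F] [Field K] [Algebra F K]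

theorem exists_add_mul_of_finrank_eq_two (hfin : Module.finrank F K = 2) {a : K}
    (ha : a ∉ (algebraMap F K).range) (x : K) :
    ∃ p q : F, x = algebraMap F K p + algebraMap F K q * a := by
  have hli : LinearIndependent F ![1, a] := by
    rw [LinearIndependent.pair_iff]
    intro s t hst
    have ht : t = 0 := by
      by_contra ht
      refine ha ⟨-s / t, ?_⟩
      have ht' : algebraMap F K t ≠ 0 := by simpa using ht
      rw [Algebra.smul_def, Algebra.smul_def] at hst
      rw [map_div₀, map_neg]
      field_simp
      linear_combination -hst
    subst ht
    simpa [Algebra.smul_def] using hst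
  have := FiniteDimensional.of_finrank_eq_succ hfin
  have hx : x ∈ Submodule.span F (Set.range ![1, a]) := by
    rw [hli.span_eq_top_of_card_eq_finrank' (by simp [hfin])]
    trivial
  rw [Matrix.range_cons, Matrix.range_cons, Matrix.range_empty, Set.union_empty,
    Set.singleton_union, Submodule.mem_span_pair] at hx
  obtain ⟨p, q, rfl⟩ := hx
  exact ⟨p, q, by simp [Algebra.smul_def]⟩

theorem exists_sq_eq_of_finrank_eq_two [CharZero F] (hfin : Module.finrank F K = 2) :
    ∃ δ : K, δ ∉ (algebraMap F K).range ∧ δ ^ 2 ∈ (algebraMap F K).range := by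
  obtain ⟨a, ha⟩ : ∃ a : K, a ∉ (algebraMap F K).range := by
    by_contra! h
    have := (finrank_eq_one_iff_of_nonzero' (1 : K) one_ne_zero).2 fun w ↦ by
      obtain ⟨c, hc⟩ := h w
      exact ⟨c, by rw [Algebra.smul_def, hc, mul_one]⟩
    omega
  obtain ⟨p, q, hpq⟩ := exists_add_mul_of_finrank_eq_two hfin ha (a ^ 2)
  have := charZero_of_injective_algebraMap (algebraMap F K).injective
  -- Completing the square in `a ^ 2 = p + q * a`.
  refine ⟨2 * a - algebraMap F K q, fun ⟨c, hc⟩ ↦ ha ⟨(c + q) / 2, ?_⟩, 4 * p + q ^ 2, ?_⟩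
  · rw [map_div₀, map_add, hc, map_ofNat]
    ring
  · rw [map_add, map_mul, map_pow, map_ofNat]
    linear_combination -4 * hpq

theorem exists_mul_eq_of_sq_mem_range [CharZero F] (hfin : Module.finrank F K = 2) {δ : K}
    (hδ : δ ∉ (algebraMap F K).range) (hδ2 : δ ^ 2 ∈ (algebraMap F K).range) {x : K}
    (hx : x ∉ (algebraMap F K).range) (hx2 : x ^ 2 ∈ (algebraMap F K).range) :
    ∃ q : F, q ≠ 0 ∧ x = algebraMap F K q * δ := by
  have := charZero_of_injective_algebraMap (algebraMap F K).injective
  obtain ⟨p, q, rfl⟩ := exists_add_mul_of_finrank_eq_two hfin hδ x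
  have hq : q ≠ 0 := by
    rintro rfl
    exact hx ⟨p, by simp⟩
  have hq' : algebraMap F K q ≠ 0 := by simpa using hq
  refine ⟨q, hq, ?_⟩
  have hp : p = 0 := by
    by_contra hp
    have hp' : algebraMap F K p ≠ 0 := by simpa using hp
    obtain ⟨c, hc⟩ := hx2
    obtain ⟨d, hd⟩ := hδ2
    -- If `p ≠ 0`, the cross term `2pqδ` of `(p + qδ)²` lets one solve for `δ` in `F`.
    refine hδ ⟨(c - p ^ 2 - q ^ 2 * d) / (2 * p * q), ?_⟩
    simp only [map_div₀, map_sub, map_mul, map_pow, hc, hd, map_ofNat]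
    field_simp
    ring
  simp [hp]

theorem exists_quadratic_relation [NumberField F] [NumberField K] (hfin : Module.finrank F K = 2)
    (a : 𝓞 K) (ha : (a : K) ∉ (algebraMap F K).range) :
    ∃ t n : 𝓞 F, (a : K) ^ 2 - algebraMap F K t * a + algebraMap F K n = 0 := by
  have hint : IsIntegral (𝓞 F) (a : K) := a.isIntegral_coe.tower_top
  set P := minpoly (𝓞 F) (a : K) with hP
  have hmon : P.Monic := minpoly.monic hint
  have hdeg : P.natDegree = 2 := by
    have h1 : (minpoly F (a : K)).natDegree = P.natDegree := by
      rw [minpoly.isIntegrallyClosed_eq_field_fractions' F hint, hmon.natDegree_map]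
    have := FiniteDimensional.of_finrank_eq_succ hfin
    refine le_antisymm ?_ ?_
    · rw [← h1, ← hfin]
      exact minpoly.natDegree_le _
    · rw [← h1]
      exact (minpoly.two_le_natDegree_iff (Algebra.IsIntegral.isIntegral _)).2 ha
  have h0 := minpoly.aeval (𝓞 F) (a : K)
  rw [← hP, Polynomial.aeval_eq_sum_range, hdeg] at h0
  refine ⟨-P.coeff 1, P.coeff 0, ?_⟩
  have h2 : P.coeff 2 = 1 := by rw [← hdeg]; exact hmon
  simp only [Finset.sum_range_succ, Finset.sum_range_zero, Algebra.smul_def, h2] at h0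
  simp only [← IsScalarTower.algebraMap_apply (𝓞 F) F K, map_neg, map_one] at h0 ⊢
  linear_combination h0

end

/-! ### Inert extensions give unramified discriminants -/

section

variable {ℓ : ℕ} [Fact ℓ.Prime]
variable {F K : Type*} [Field F] [Field K]

theorem AllEmbeddingsAdic.exists_padicInt (hF : AllEmbeddingsAdic ℓ F) (φ : F →+* PadicAlgCl ℓ)
    (x : 𝓞 F) : ∃ z : ℤ_[ℓ], algebraMap ℚ_[ℓ] (PadicAlgCl ℓ) z = φ x := by
  obtain ⟨z, hz⟩ := hF φ x
  refine ⟨⟨z, ?_⟩, hz⟩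
  rw [← PadicAlgCl.norm_extends, hz]
  exact norm_map_ringOfIntegers_le_one φ x

/-- Take an integer `a` generating the residue extension, with trace `t` and norm `n`. Then `2a - t`
is an `F`-multiple of `δ`, so `δ²` agrees with `t² - 4n` up to a square. -/
theorem AllEmbeddingsAdic.isUnramifiedDiscriminant [NumberField F] [NumberField K] [Algebra F K]
    (hF : AllEmbeddingsAdic ℓ F)
    (hfin : Module.finrank F K = 2) (h : IsTotallyInertAbove ℓ F K) {δ : K}
    (hδ : δ ∉ (algebraMap F K).range) (hδ2 : δ ^ 2 ∈ (algebraMap F K).range)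
    (φ : K →+* PadicAlgCl ℓ) :
    ∃ d : ℚ_[ℓ], IsUnramifiedDiscriminant d ∧ algebraMap ℚ_[ℓ] (PadicAlgCl ℓ) d = φ δ ^ 2 := by
  obtain ⟨a, ha⟩ := hF.exists_sub_intCast_notMem hfin h φ
  have ha' : ∀ z : ℤ_[ℓ], ¬ ‖φ a - algebraMap ℚ_[ℓ] (PadicAlgCl ℓ) z‖ < 1 := by
    intro z hz
    obtain ⟨n, hn⟩ := PadicAlgCl.exists_intCast_norm_sub_lt_one z.2
    refine ha n ?_
    rw [mem_adicPrime]
    simpa using PadicAlgCl.norm_add_lt_one hz hn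
  have haF : (a : K) ∉ (algebraMap F K).range := by
    rintro ⟨y, hy⟩
    have hyint : IsIntegral ℤ y := by
      rw [← isIntegral_algebraMap_iff (algebraMap F K).injective, hy]
      exact a.isIntegral_coe
    obtain ⟨y', rfl⟩ : ∃ y' : 𝓞 F, (y' : F) = y := ⟨⟨y, hyint⟩, rfl⟩
    obtain ⟨z, hz⟩ := hF.exists_padicInt (φ.comp (algebraMap F K)) y'
    refine ha' z ?_
    rw [hz, ← hy, RingHom.comp_apply, sub_self, norm_zero]
    exact one_pos
  obtain ⟨t, n, htn⟩ := exists_quadratic_relation hfin a haF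
  obtain ⟨T, hT⟩ := hF.exists_padicInt (φ.comp (algebraMap F K)) t
  obtain ⟨N, hN⟩ := hF.exists_padicInt (φ.comp (algebraMap F K)) n
  rw [RingHom.comp_apply] at hT hN
  obtain ⟨q, hq, hqδ⟩ := exists_mul_eq_of_sq_mem_range hfin hδ hδ2
    (x := 2 * a - algebraMap F K t)
    (fun ⟨c, hc⟩ ↦ haF ⟨(c + t) / 2, by
      rw [map_div₀, map_add, hc, map_ofNat]
      ring⟩)
    ⟨t ^ 2 - 4 * n, by
      simp only [map_sub, map_mul, map_pow, map_ofNat]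
      linear_combination -4 * htn⟩
  obtain ⟨Q, hQ⟩ := hF (φ.comp (algebraMap F K)) q
  rw [RingHom.comp_apply] at hQ
  have hQ0 : Q ≠ 0 := by
    rintro rfl
    rw [map_zero, eq_comm, map_eq_zero, map_eq_zero] at hQ
    exact hq hQ
  have hφ : φ a ^ 2 - algebraMap ℚ_[ℓ] (PadicAlgCl ℓ) T * φ a +
      algebraMap ℚ_[ℓ] (PadicAlgCl ℓ) N = 0 := by
    rw [hT, hN, ← map_pow, ← map_mul, ← map_sub, ← map_add, htn, map_zero]
  have hφδ : 2 * φ a - algebraMap ℚ_[ℓ] (PadicAlgCl ℓ) T =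
      algebraMap ℚ_[ℓ] (PadicAlgCl ℓ) Q * φ δ := by
    rw [hT, hQ, ← map_mul, ← hqδ, map_sub, map_mul, map_ofNat]
  refine ⟨Q⁻¹ ^ 2 * ((T ^ 2 - 4 * N : ℤ_[ℓ]) : ℚ_[ℓ]),
    ⟨Q⁻¹, T, N, inv_ne_zero hQ0, rfl, fun r hr ↦ ?_⟩, ?_⟩
  -- A root `r` mod `ℓ` would make `a` congruent to `r` or to the other root `T - r`, contradicting
  -- `ha'`.
  · have hr' : ‖(φ a - algebraMap ℚ_[ℓ] (PadicAlgCl ℓ) r) *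
        (φ a - algebraMap ℚ_[ℓ] (PadicAlgCl ℓ) ((T - r : ℤ_[ℓ]) : ℚ_[ℓ]))‖ < 1 := by
      have heq : (φ a - algebraMap ℚ_[ℓ] (PadicAlgCl ℓ) r) *
          (φ a - algebraMap ℚ_[ℓ] (PadicAlgCl ℓ) ((T - r : ℤ_[ℓ]) : ℚ_[ℓ])) =
          -algebraMap ℚ_[ℓ] (PadicAlgCl ℓ) ((r ^ 2 - T * r + N : ℤ_[ℓ]) : ℚ_[ℓ]) := by
        rw [show ((T - r : ℤ_[ℓ]) : ℚ_[ℓ]) = T - r by norm_cast,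
          show ((r ^ 2 - T * r + N : ℤ_[ℓ]) : ℚ_[ℓ]) = r ^ 2 - T * r + N by norm_cast]
        simp only [map_sub, map_add, map_mul, map_pow]
        linear_combination hφ
      rwa [heq, norm_neg, PadicAlgCl.norm_extends, ← PadicInt.norm_def]
    rw [norm_mul] at hr'
    by_contra! _
    have h1 := not_lt.1 (ha' r)
    have h2 := not_lt.1 (ha' (T - r))
    exact absurd hr' (not_lt.2 (one_le_mul_of_one_le_of_one_le h1 h2))
  · have hQ' : algebraMap ℚ_[ℓ] (PadicAlgCl ℓ) Q ≠ 0 := by simpa using hQ0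
    rw [show ((T ^ 2 - 4 * N : ℤ_[ℓ]) : ℚ_[ℓ]) = T ^ 2 - 4 * N by norm_cast]
    simp only [map_sub, map_mul, map_pow, map_inv₀, map_ofNat]
    field_simp
    linear_combination -4 * hφ + (2 * φ a - algebraMap ℚ_[ℓ] (PadicAlgCl ℓ) T +
      algebraMap ℚ_[ℓ] (PadicAlgCl ℓ) Q * φ δ) * hφδ

end

theorem IntermediateField.finrank_adjoin_simple_of_sq_mem {E Qbar : Type*} [Field E] [Field Qbar]
    [Algebra E Qbar]
    {δ : Qbar} (hδ : δ ∉ (algebraMap E Qbar).range) (hδ2 : δ ^ 2 ∈ (algebraMap E Qbar).range) :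
    Module.finrank E (IntermediateField.adjoin E {δ}) = 2 := by
  obtain ⟨d, hd⟩ := hδ2
  have hmon : (.X ^ 2 - .C d : Polynomial E).Monic := Polynomial.monic_X_pow_sub_C d two_ne_zero
  have hroot : Polynomial.aeval δ (.X ^ 2 - .C d : Polynomial E) = 0 := by simp [hd]
  have hint : IsIntegral E δ := ⟨_, hmon, hroot⟩
  rw [IntermediateField.adjoin.finrank hint]
  refine le_antisymm ?_ ((minpoly.two_le_natDegree_iff hint).2 hδ)
  rw [← Polynomial.natDegree_X_pow_sub_C (n := 2) (r := d)]
  exact Polynomial.natDegree_le_of_dvd (minpoly.dvd _ _ hroot) hmon.ne_zero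

/-! ### The totally `ℓ`-adic subfield, and composita of unramified quadratic fields -/

section

variable {ℓ : ℕ} [Fact ℓ.Prime]
variable {Qbar : Type*} [Field Qbar] [CharZero Qbar] (ι : Qbar →+* AlgebraicClosure ℚ_[ℓ])

/-- Extend `φ` to `ℚ̄`; by normality the image is that of `ι`, so the extension differs from `ι` by
an automorphism. This matches conjugates of `K` with embeddings. -/
theorem exists_algEquiv_of_embedding [IsAlgClosure ℚ Qbar] {K : Type*} [Field K] [Algebra K Qbar]
    [CharZero K]
    (φ : K →+* PadicAlgCl ℓ) : ∃ σ : Qbar ≃ₐ[ℚ] Qbar, ∀ x : K, φ x = ι (σ (algebraMap K Qbar x)) := by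
  have := IsAlgClosure.isAlgebraic (R := ℚ) (K := Qbar)
  have : Normal ℚ Qbar := IsAlgClosure.normal ℚ Qbar
  have : IsScalarTower ℚ K Qbar := IsScalarTower.of_algebraMap_eq' (Subsingleton.elim _ _)
  have : Algebra.IsAlgebraic K Qbar := Algebra.IsAlgebraic.tower_top (K := ℚ) K
  obtain ⟨ψ, hψ⟩ := IsAlgClosed.surjective_domRestrict_of_isAlgebraic (K := ℚ) (L := K)
    (E := Qbar) (M := PadicAlgCl ℓ) φ.toRatAlgHom
  let : Algebra Qbar (PadicAlgCl ℓ) := ι.toAlgebra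
  have : IsScalarTower ℚ Qbar (PadicAlgCl ℓ) :=
    IsScalarTower.of_algebraMap_eq' (Subsingleton.elim _ _)
  refine ⟨AlgHom.restrictNormal' ψ Qbar, fun x ↦ ?_⟩
  exact (DFunLike.congr_fun hψ x).symm.trans
    (AlgHom.restrictNormal_commutes ψ Qbar (algebraMap K Qbar x)).symm

/-- The largest totally `ℓ`-adic subfield of `ℚ̄`. -/
noncomputable def totallyAdicSubfield : IntermediateField ℚ Qbar :=
  ⨅ σ : Qbar ≃ₐ[ℚ] Qbar, ((algebraMap ℚ_[ℓ] (PadicAlgCl ℓ)).toRatAlgHom.fieldRange.comap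
    ι.toRatAlgHom).comap (σ : Qbar →ₐ[ℚ] Qbar)

variable {ι}

theorem mem_totallyAdicSubfield {x : Qbar} : x ∈ totallyAdicSubfield ι ↔
    ∀ σ : Qbar ≃ₐ[ℚ] Qbar, ι (σ x) ∈ (algebraMap ℚ_[ℓ] (PadicAlgCl ℓ)).range := by
  rw [totallyAdicSubfield, ← SetLike.mem_coe, IntermediateField.coe_iInf, Set.mem_iInter]
  rfl

theorem isTotallyAdic_iff_le {K : IntermediateField ℚ Qbar} :
    IsTotallyAdic ι K ↔ K ≤ totallyAdicSubfield ι := by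
  refine ⟨fun h x hx ↦ mem_totallyAdicSubfield.2 fun σ ↦ h σ _ ⟨x, hx, rfl⟩, ?_⟩
  rintro h σ _ ⟨x, hx, rfl⟩
  exact mem_totallyAdicSubfield.1 (h hx) σ

theorem IsTotallyAdic.sup {K K' : IntermediateField ℚ Qbar} (h : IsTotallyAdic ι K)
    (h' : IsTotallyAdic ι K') : IsTotallyAdic ι (K ⊔ K') :=
  isTotallyAdic_iff_le.2 (sup_le (isTotallyAdic_iff_le.1 h) (isTotallyAdic_iff_le.1 h'))

theorem IsTotallyAdic.allEmbeddingsAdic [IsAlgClosure ℚ Qbar] {K : IntermediateField ℚ Qbar}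
    (h : IsTotallyAdic ι K) : AllEmbeddingsAdic ℓ K := by
  intro φ x
  obtain ⟨σ, hσ⟩ := exists_algEquiv_of_embedding ι φ
  rw [hσ]
  exact h σ _ ⟨x, x.2, rfl⟩

theorem IntermediateField.numberField_of_le {F K : IntermediateField ℚ Qbar} (h : F ≤ K)
    [NumberField K] : NumberField F where
  to_finiteDimensional := Module.Finite.of_injective (IntermediateField.inclusion h).toLinearMap
    (IntermediateField.inclusion h).injective

theorem IntermediateField.numberField_extendScalars {F K : IntermediateField ℚ Qbar} (h : F ≤ K)
    [NumberField K] : NumberField (IntermediateField.extendScalars h) :=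
  ‹NumberField K›

theorem mem_range_algebraMap_extendScalars {F K : IntermediateField ℚ Qbar} (h : F ≤ K)
    {x : IntermediateField.extendScalars h} :
    x ∈ (algebraMap F (IntermediateField.extendScalars h)).range ↔ (x : Qbar) ∈ F :=
  ⟨fun ⟨y, hy⟩ ↦ hy ▸ y.2, fun hx ↦ ⟨⟨x, hx⟩, rfl⟩⟩

theorem notMem_totallyAdicSubfield_of_discriminant {δ : Qbar} {d : ℚ_[ℓ]}
    (hd : IsUnramifiedDiscriminant d) (hδ : algebraMap ℚ_[ℓ] (PadicAlgCl ℓ) d = ι δ ^ 2) :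
    δ ∉ totallyAdicSubfield ι := by
  intro h
  obtain ⟨z, hz⟩ := mem_totallyAdicSubfield.1 h AlgEquiv.refl
  refine hd.not_isSquare ⟨z, (algebraMap ℚ_[ℓ] (PadicAlgCl ℓ)).injective ?_⟩
  rw [hδ, map_mul, hz, pow_two]
  rfl

/-- Under each embedding `(δ/δ')² = dd'/d'²`, and `dd'` is a square in `ℚ_ℓ`. -/
theorem div_mem_totallyAdicSubfield {δ δ' : Qbar}
    (hδ : ∀ σ : Qbar ≃ₐ[ℚ] Qbar, ∃ d : ℚ_[ℓ], IsUnramifiedDiscriminant d ∧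
      algebraMap ℚ_[ℓ] (PadicAlgCl ℓ) d = ι (σ δ) ^ 2)
    (hδ' : ∀ σ : Qbar ≃ₐ[ℚ] Qbar, ∃ d : ℚ_[ℓ], IsUnramifiedDiscriminant d ∧
      algebraMap ℚ_[ℓ] (PadicAlgCl ℓ) d = ι (σ δ') ^ 2) : δ / δ' ∈ totallyAdicSubfield ι := by
  refine mem_totallyAdicSubfield.2 fun σ ↦ ?_
  obtain ⟨d, hd, hdδ⟩ := hδ σ
  obtain ⟨d', hd', hdδ'⟩ := hδ' σ
  obtain ⟨u, hu⟩ := hd.isSquare_mul hd'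
  have hd0 : algebraMap ℚ_[ℓ] (PadicAlgCl ℓ) d' ≠ 0 := by simpa using hd'.ne_zero
  have hsq : (ι (σ (δ / δ')) : PadicAlgCl ℓ) ^ 2 =
      (algebraMap ℚ_[ℓ] (PadicAlgCl ℓ) (u / d')) ^ 2 := by
    have hu' := congrArg (algebraMap ℚ_[ℓ] (PadicAlgCl ℓ)) hu
    rw [map_mul, map_mul] at hu'
    rw [map_div₀, map_div₀, map_div₀, div_pow, ← hdδ, ← hdδ', div_pow]
    field_simp
    linear_combination hu'
  rcases sq_eq_sq_iff_eq_or_eq_neg.1 hsq with h | h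
  · exact ⟨_, h.symm⟩
  · exact ⟨-(u / d'), by rw [h, map_neg]⟩

variable [IsAlgClosure ℚ Qbar]

theorem isTotallyInertAbove_extendScalars {F K : IntermediateField ℚ Qbar} (h : F ≤ K)
    [NumberField K] (hF : IsTotallyAdic ι F)
    (hfin : Module.finrank F (IntermediateField.extendScalars h) = 2)
    (ha : ∀ σ : Qbar ≃ₐ[ℚ] Qbar, ∃ a ∈ K, IsIntegral ℤ a ∧
      ∀ n : ℤ, ¬ ‖(ι (σ a) : PadicAlgCl ℓ) - n‖ < 1) :
    IsTotallyInertAbove ℓ F (IntermediateField.extendScalars h) := by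
  have := IntermediateField.numberField_of_le h
  have := IntermediateField.numberField_extendScalars h
  refine hF.allEmbeddingsAdic.isTotallyInertAbove hfin fun φ ↦ ?_
  obtain ⟨σ, hσ⟩ := exists_algEquiv_of_embedding ι φ
  obtain ⟨a, haK, haint, han⟩ := ha σ
  have hint : IsIntegral ℤ (⟨a, haK⟩ : IntermediateField.extendScalars h) := by
    rwa [← isIntegral_algebraMap_iff (algebraMap (IntermediateField.extendScalars h) Qbar).injective]
  refine ⟨⟨⟨a, haK⟩, hint⟩, fun n hn ↦ han n ?_⟩
  have hn' := sub_intCast_mem_adicPrime.1 hn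
  rw [hσ] at hn'
  exact hn'

theorem HasUnramifiedQuadraticAdicConjugation.exists_sqrt {K : IntermediateField ℚ Qbar}
    [NumberField K] (hK : HasUnramifiedQuadraticAdicConjugation ι K) :
    ∃ F ≤ K, IsTotallyAdic ι F ∧ ∃ δ ∈ K, δ ^ 2 ∈ F ∧
      (∀ x ∈ K, ∃ p ∈ F, ∃ q ∈ F, x = p + q * δ) ∧
      (∀ σ : Qbar ≃ₐ[ℚ] Qbar, ∃ d : ℚ_[ℓ], IsUnramifiedDiscriminant d ∧
        algebraMap ℚ_[ℓ] (PadicAlgCl ℓ) d = ι (σ δ) ^ 2) ∧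
      ∀ σ : Qbar ≃ₐ[ℚ] Qbar, ∃ a ∈ K, IsIntegral ℤ a ∧
        ∀ n : ℤ, ¬ ‖(ι (σ a) : PadicAlgCl ℓ) - n‖ < 1 := by
  obtain ⟨F, h, hF, hfin, hinert⟩ := hK
  have := IntermediateField.numberField_of_le h
  have := IntermediateField.numberField_extendScalars h
  obtain ⟨δ, hδ, hδ2⟩ := exists_sq_eq_of_finrank_eq_two hfin
  refine ⟨F, h, hF, δ, δ.2, (mem_range_algebraMap_extendScalars h).1 hδ2, fun x hx ↦ ?_,
    fun σ ↦ ?_, fun σ ↦ ?_⟩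
  · obtain ⟨p, q, hpq⟩ := exists_add_mul_of_finrank_eq_two hfin hδ ⟨x, hx⟩
    exact ⟨p, p.2, q, q.2, congrArg Subtype.val hpq⟩
  · exact hF.allEmbeddingsAdic.isUnramifiedDiscriminant hfin hinert hδ hδ2
      ((ι.comp (σ : Qbar →+* Qbar)).comp (algebraMap _ Qbar))
  · obtain ⟨a, ha⟩ := hF.allEmbeddingsAdic.exists_sub_intCast_notMem hfin hinert
      ((ι.comp (σ : Qbar →+* Qbar)).comp (algebraMap _ Qbar))
    refine ⟨(a : IntermediateField.extendScalars h), (a : IntermediateField.extendScalars h).2,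
      a.isIntegral_coe.map (IntermediateField.val _).toRingHom.toIntAlgHom, fun n hn ↦ ha n ?_⟩
    exact sub_intCast_mem_adicPrime.2 hn

theorem HasUnramifiedQuadraticAdicConjugation.sup {K K' : IntermediateField ℚ Qbar}
    [NumberField K] [NumberField K'] (hK : HasUnramifiedQuadraticAdicConjugation ι K)
    (hK' : HasUnramifiedQuadraticAdicConjugation ι K') :
    HasUnramifiedQuadraticAdicConjugation ι (K ⊔ K') := by
  obtain ⟨F, hFK, hF, δ, hδK, hδ2, hspan, hdisc, hres⟩ := hK.exists_sqrt
  obtain ⟨F', hFK', hF', δ', hδK', hδ2', hspan', hdisc', -⟩ := hK'.exists_sqrt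
  have : NumberField ↥(K ⊔ K') := { to_finiteDimensional := IntermediateField.finiteDimensional_sup K K' }
  set r := δ / δ' with hr
  let E := F ⊔ F' ⊔ IntermediateField.adjoin ℚ {r}
  have hrE : r ∈ E := (le_sup_right : _ ≤ E) (IntermediateField.mem_adjoin_simple_self ℚ r)
  have hFE : F ≤ E := le_sup_left.trans le_sup_left
  have hFE' : F' ≤ E := le_sup_right.trans le_sup_left
  have hET : IsTotallyAdic ι E := by
    refine (hF.sup hF').sup (isTotallyAdic_iff_le.2 ?_)
    rw [IntermediateField.adjoin_simple_le_iff]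
    exact div_mem_totallyAdicSubfield hdisc hdisc'
  have hEB : E ≤ K ⊔ K' := by
    refine sup_le (sup_le_sup hFK hFK') ?_
    rw [IntermediateField.adjoin_simple_le_iff]
    exact div_mem ((le_sup_left : K ≤ K ⊔ K') hδK) ((le_sup_right : K' ≤ K ⊔ K') hδK')
  obtain ⟨d, hd, hdδ⟩ := hdisc AlgEquiv.refl
  have hδT := notMem_totallyAdicSubfield_of_discriminant hd hdδ
  have hδ0 : δ ≠ 0 := fun h ↦ hδT (h ▸ zero_mem _)
  have hδE : δ ∉ (algebraMap E Qbar).range := fun ⟨y, hy⟩ ↦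
    hδT (isTotallyAdic_iff_le.1 hET (hy ▸ y.2))
  -- `K` is generated by `δ` over `F`, and `K'` over `F'` by `δ' = δ / r` with `r ∈ E`.
  have hB : IntermediateField.extendScalars hEB = IntermediateField.adjoin E {δ} := by
    refine le_antisymm ?_ ?_
    · have hle : K ⊔ K' ≤ (IntermediateField.adjoin E {δ}).restrictScalars ℚ := by
        have hE : ∀ x ∈ E, x ∈ IntermediateField.adjoin E {δ} := fun x hx ↦
          (IntermediateField.adjoin E {δ}).algebraMap_mem ⟨x, hx⟩
        have hδ := IntermediateField.mem_adjoin_simple_self E δ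
        refine sup_le (fun x hx ↦ ?_) fun x hx ↦ ?_
        · obtain ⟨p, hp, q, hq, rfl⟩ := hspan x hx
          exact add_mem (hE p (hFE hp)) (mul_mem (hE q (hFE hq)) hδ)
        · obtain ⟨p, hp, q, hq, rfl⟩ := hspan' x hx
          have : δ' = δ / r := by
            rw [hr, div_div_cancel₀ hδ0]
          rw [this]
          exact add_mem (hE p (hFE' hp)) (mul_mem (hE q (hFE' hq)) (div_mem hδ (hE r hrE)))
      exact fun x hx ↦ hle hx
    · rw [IntermediateField.adjoin_simple_le_iff]
      exact (le_sup_left : K ≤ K ⊔ K') hδK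
  have hfin : Module.finrank E (IntermediateField.extendScalars hEB) = 2 := by
    rw [hB]
    exact IntermediateField.finrank_adjoin_simple_of_sq_mem hδE ⟨⟨δ ^ 2, hFE hδ2⟩, rfl⟩
  refine ⟨E, hEB, hET, hfin, isTotallyInertAbove_extendScalars hEB hET hfin fun σ ↦ ?_⟩
  obtain ⟨a, haK, ha⟩ := hres σ
  exact ⟨a, (le_sup_left : K ≤ K ⊔ K') haK, ha⟩

end

/-! ### Ingredients of the counterexample -/

theorem exists_int_forall_not_dvd_quadratic (ℓ : ℕ) [Fact ℓ.Prime] :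
    ∃ n : ℤ, ∀ r : ℤ, ¬ (ℓ : ℤ) ∣ r ^ 2 - r + n := by
  -- On a finite set a non-injective map misses a value, and minus that value serves as `n`.
  have hinj : ¬ Function.Injective fun x : ZMod ℓ ↦ x ^ 2 - x := fun h ↦
    zero_ne_one (h (a₁ := 0) (a₂ := 1) (by simp))
  rw [Finite.injective_iff_surjective] at hinj
  simp only [Function.Surjective, not_forall, not_exists] at hinj
  obtain ⟨m, hm⟩ := hinj
  obtain ⟨n, rfl⟩ := ZMod.intCast_surjective m
  refine ⟨-n, fun r hr ↦ hm r ?_⟩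
  rw [← ZMod.intCast_zmod_eq_zero_iff_dvd] at hr
  push_cast at hr
  linear_combination hr

theorem not_dvd_one_sub_four_mul {ℓ : ℕ} [Fact ℓ.Prime] {n : ℤ}
    (hn : ∀ r : ℤ, ¬ (ℓ : ℤ) ∣ r ^ 2 - r + n) : ¬ (ℓ : ℤ) ∣ 1 - 4 * n := by
  intro h
  have hp := (Fact.out : ℓ.Prime)
  rcases hp.eq_two_or_odd' with rfl | ⟨k, hk⟩
  · norm_num at h
    omega
  · have hk' : (ℓ : ℤ) = 2 * k + 1 := by exact_mod_cast hk
    -- `k + 1` is the inverse of 2 mod `ℓ`, the double root if the discriminant vanished.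
    have hdvd : (ℓ : ℤ) ∣ 2 * (2 * ((k + 1 : ℤ) ^ 2 - (k + 1) + n)) := by
      obtain ⟨c, hc⟩ := h
      exact ⟨ℓ - c, by linear_combination -hc - (ℓ + 2 * k + 1) * hk'⟩
    have h2 : ¬ (ℓ : ℤ) ∣ 2 := by
      intro h
      have := (Nat.prime_dvd_prime_iff_eq hp Nat.prime_two).1 (by exact_mod_cast h)
      omega
    have hp' := Nat.prime_iff_prime_int.1 hp
    exact hn _ (((hp'.dvd_or_dvd hdvd).resolve_left h2 |> hp'.dvd_or_dvd).resolve_left h2)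

theorem IsAlgClosed.exists_quadratic_root {k : Type*} [Field k] [IsAlgClosed k] [CharZero k]
    (b c : k) : ∃ x : k, x ^ 2 - b * x + c = 0 := by
  obtain ⟨z, hz⟩ := IsAlgClosed.exists_pow_nat_eq (b ^ 2 - 4 * c) (n := 2) two_pos
  refine ⟨(b + z) / 2, ?_⟩
  field_simp
  linear_combination hz

section

variable {ℓ : ℕ} [Fact ℓ.Prime] {n : ℤ} {K : Type*} [Field K]

/-- If `w` were congruent to `m`, then `m` would be a root of `X² - X + n` mod `ℓ`. -/
theorem not_norm_sub_intCast_lt_one (hn : ∀ r : ℤ, ¬ (ℓ : ℤ) ∣ r ^ 2 - r + n)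
    {w : PadicAlgCl ℓ} (hint : IsIntegral ℤ w) (hw : ‖w ^ 2 - w + n‖ < 1) (m : ℤ) :
    ¬ ‖w - m‖ < 1 := by
  intro hm
  have hle : ‖1 - w - m‖ ≤ 1 := PadicAlgCl.norm_le_one_of_isIntegral
    ((isIntegral_one.sub hint).sub (isIntegral_intCast m))
  have heq : ((m ^ 2 - m + n : ℤ) : PadicAlgCl ℓ) = (w - m) * (1 - w - m) + (w ^ 2 - w + n) := by
    push_cast
    ring
  refine hn m ((PadicAlgCl.norm_intCast_lt_one_iff _).1 ?_)
  rw [heq]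
  exact PadicAlgCl.norm_add_lt_one (PadicAlgCl.norm_mul_lt_one hm hle) hw

theorem exists_sub_intCast_notMem_of_norm_lt (hn : ∀ r : ℤ, ¬ (ℓ : ℤ) ∣ r ^ 2 - r + n)
    (φ : K →+* PadicAlgCl ℓ) {w : K} (hint : IsIntegral ℤ w)
    (hw : ‖φ w ^ 2 - φ w + n‖ < 1) : ∃ a : 𝓞 K, ∀ m : ℤ, a - m ∉ adicPrime φ := by
  obtain ⟨w, rfl⟩ : ∃ w' : 𝓞 K, (w' : K) = w := ⟨⟨w, hint⟩, rfl⟩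
  refine ⟨w, fun m hm ↦ ?_⟩
  rw [sub_intCast_mem_adicPrime] at hm
  exact not_norm_sub_intCast_lt_one hn (map_isIntegral_int φ hint) hw m hm

theorem isIntegral_of_quadratic {A : Type*} [CommRing A] {x b c : A}
    (hb : IsIntegral ℤ b) (hc : IsIntegral ℤ c) (h : x ^ 2 - b * x + c = 0) : IsIntegral ℤ x := by
  let b' : integralClosure ℤ A := ⟨b, hb⟩
  let c' : integralClosure ℤ A := ⟨c, hc⟩
  refine isIntegral_trans (A := integralClosure ℤ A) x
    ⟨.X ^ 2 - .C b' * .X + .C c', by monicity!, ?_⟩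
  simpa using! h

/-- From `b² = (b - n)(1 - t)`, `b` lies in the prime and `b - n` is a unit there, so `1 - t`, and
with it `ℓ = t(1 - t)`, lies in the square. -/
theorem natCast_mem_adicPrime_sq_of_eisenstein [NumberField K] (hn : ¬ (ℓ : ℤ) ∣ n)
    (φ : K →+* PadicAlgCl ℓ) {t b : 𝓞 K} (ht : t ^ 2 - t + ℓ = 0)
    (hb : b ^ 2 - (1 - t) * b + (1 - t) * n = 0) (hφ : 1 - t ∈ adicPrime φ) :
    (ℓ : 𝓞 K) ∈ adicPrime φ ^ 2 := by
  have := isMaximal_of_mem_placesAbove (adicPrime_mem_placesAbove φ)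
  have hbmem : b ∈ adicPrime φ := by
    refine (adicPrime_isPrime φ).mem_of_pow_mem 2 ?_
    rw [show b ^ 2 = (b - n) * (1 - t) by linear_combination hb]
    exact Ideal.mul_mem_left _ _ hφ
  have hu : b - n ∉ adicPrime φ := by
    intro h
    have h' := sub_mem hbmem h
    rw [sub_sub_cancel, mem_adicPrime] at h'
    exact hn ((PadicAlgCl.norm_intCast_lt_one_iff n).1 (by simpa using h'))
  obtain ⟨v, i, hi, hv⟩ := Ideal.IsMaximal.exists_inv this hu
  have key : 1 - t ∈ adicPrime φ ^ 2 := by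
    have h1 : (1 - t) * i ∈ adicPrime φ ^ 2 := by
      rw [pow_two]
      exact Ideal.mul_mem_mul hφ hi
    have h2 : v * b ^ 2 ∈ adicPrime φ ^ 2 := Ideal.mul_mem_left _ _ (Ideal.pow_mem_pow hbmem 2)
    rw [show 1 - t = (1 - t) * i + v * b ^ 2 by linear_combination (-(1 - t)) * hv - v * hb]
    exact add_mem h1 h2
  rw [show (ℓ : 𝓞 K) = t * (1 - t) by linear_combination ht]
  exact Ideal.mul_mem_left _ _ key

end

section

variable {Qbar : Type*} [Field Qbar] [CharZero Qbar]

theorem IntermediateField.finrank_extendScalars_le_two {F M : IntermediateField ℚ Qbar} (h : F ≤ M)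
    {x b c : Qbar} (hM : M ≤ F ⊔ IntermediateField.adjoin ℚ {x}) (hb : b ∈ F) (hc : c ∈ F)
    (hx : x ^ 2 - b * x + c = 0) : Module.finrank F (IntermediateField.extendScalars h) ≤ 2 := by
  have hle : IntermediateField.extendScalars h ≤ IntermediateField.adjoin F {x} := by
    have : F ⊔ IntermediateField.adjoin ℚ {x} ≤
        (IntermediateField.adjoin F {x}).restrictScalars ℚ := by
      refine sup_le (fun y hy ↦ (IntermediateField.adjoin F {x}).algebraMap_mem ⟨y, hy⟩) ?_
      rw [IntermediateField.adjoin_simple_le_iff]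
      exact IntermediateField.mem_adjoin_simple_self F x
    exact fun y hy ↦ this (hM hy)
  let P : Polynomial F := .X ^ 2 - .C ⟨b, hb⟩ * .X + .C ⟨c, hc⟩
  have hP : P.Monic := by
    simp only [P]
    monicity!
  have hPx : Polynomial.aeval x P = 0 := by simpa [P] using! hx
  have hint : IsIntegral F x := ⟨P, hP, hPx⟩
  have := IntermediateField.adjoin.finiteDimensional hint
  calc Module.finrank F (IntermediateField.extendScalars h)
      ≤ Module.finrank F (IntermediateField.adjoin F {x}) :=
        LinearMap.finrank_le_finrank_of_injective (f := (IntermediateField.inclusion hle).toLinearMap)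
          (IntermediateField.inclusion hle).injective
    _ = (minpoly F x).natDegree := IntermediateField.adjoin.finrank hint
    _ ≤ P.natDegree := Polynomial.natDegree_le_of_dvd (minpoly.dvd _ _ hPx) hP.ne_zero
    _ ≤ 2 := by
      simp only [P]
      compute_degree

theorem exists_algEquiv_eq_sub_self [IsAlgClosure ℚ Qbar] {M : IntermediateField ℚ Qbar}
    {x b c : Qbar} (hb : b ∈ M) (hc : c ∈ M) (hx : x ^ 2 - b * x + c = 0) (hxM : x ∉ M) :
    ∃ σ : Qbar ≃ₐ[ℚ] Qbar, (∀ y ∈ M, σ y = y) ∧ σ x = b - x := by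
  have : Normal ℚ Qbar := IsAlgClosure.normal ℚ Qbar
  have : IsGalois ℚ Qbar := { }
  rw [← InfiniteGalois.fixedField_fixingSubgroup M, IntermediateField.mem_fixedField_iff] at hxM
  push Not at hxM
  obtain ⟨σ, hσ, hσx⟩ := hxM
  rw [IntermediateField.mem_fixingSubgroup_iff] at hσ
  refine ⟨σ, hσ, ?_⟩
  have h1 := congrArg σ hx
  rw [map_add, map_sub, map_mul, map_pow, map_zero, hσ b hb, hσ c hc] at h1
  have h2 : (σ x - x) * (σ x + x - b) = 0 := by linear_combination h1 - hx
  linear_combination (mul_eq_zero.1 h2).resolve_left (sub_ne_zero.2 hσx)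

theorem notMem_bot_of_quadratic {θ : Qbar} {m : ℕ} (hm : m ≠ 0) (h : θ ^ 2 - θ + m = 0) :
    θ ∉ (⊥ : IntermediateField ℚ Qbar) := by
  rw [IntermediateField.mem_bot]
  rintro ⟨q, rfl⟩
  have hq : q ^ 2 - q + m = 0 := by
    apply (algebraMap ℚ Qbar).injective
    simpa using h
  have : (1 : ℚ) ≤ m := by exact_mod_cast Nat.one_le_iff_ne_zero.2 hm
  nlinarith [sq_nonneg (q - 1 / 2)]

variable {ℓ : ℕ} [Fact ℓ.Prime] {ι : Qbar →+* AlgebraicClosure ℚ_[ℓ]}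

theorem PadicInt.exists_root_sq_sub_self_add_prime : ∃ z : ℤ_[ℓ], z ^ 2 - z + ℓ = 0 := by
  -- At 0 the value is `ℓ` and the derivative is the unit `-1`.
  obtain ⟨z, hz, -⟩ := hensels_lemma (p := ℓ) (R := ℤ_[ℓ]) (F := (.X ^ 2 - .X + .C (ℓ : ℤ_[ℓ])))
    (a := 0) (by
      simpa using inv_lt_one_of_one_lt₀ (by exact_mod_cast (Fact.out : ℓ.Prime).one_lt))
  exact ⟨z, by simpa using hz⟩

theorem mem_totallyAdicSubfield_of_quadratic {θ : Qbar} (h : θ ^ 2 - θ + ℓ = 0) :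
    θ ∈ totallyAdicSubfield ι := by
  refine mem_totallyAdicSubfield.2 fun σ ↦ ?_
  obtain ⟨z, hz⟩ := PadicInt.exists_root_sq_sub_self_add_prime (ℓ := ℓ)
  have h1 := congrArg ι (congrArg σ h)
  simp only [map_add, map_sub, map_pow, map_natCast, map_zero] at h1
  have h2 := congrArg (fun x : ℤ_[ℓ] ↦ algebraMap ℚ_[ℓ] (PadicAlgCl ℓ) x) hz
  rw [show ((z ^ 2 - z + ℓ : ℤ_[ℓ]) : ℚ_[ℓ]) = z ^ 2 - z + ℓ by norm_cast] at h2
  simp only [map_add, map_sub, map_pow, map_natCast, PadicInt.coe_zero, map_zero] at h2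
  have h3 : (ι (σ θ) - algebraMap ℚ_[ℓ] (PadicAlgCl ℓ) z) *
      (ι (σ θ) - (1 - algebraMap ℚ_[ℓ] (PadicAlgCl ℓ) z)) = 0 := by linear_combination h1 - h2
  rcases mul_eq_zero.1 h3 with h | h
  · exact ⟨z, (sub_eq_zero.1 h).symm⟩
  · exact ⟨1 - z, by rw [map_sub, map_one, sub_eq_zero.1 h]⟩

end

/-! ### The two fields with `ℓ`-adic conjugation -/

section

variable {ℓ : ℕ} [Fact ℓ.Prime]

theorem isIntegral_of_sq_sub_self {A : Type*} [CommRing A] {x : A} {c : ℤ}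
    (h : x ^ 2 - x + c = 0) : IsIntegral ℤ x :=
  isIntegral_of_quadratic isIntegral_one (isIntegral_intCast c) (by rwa [one_mul])

/-- Let `b` be a root of `X² - (1 - t) X + (1 - t) n`, where `t (1 - t) = ℓ`. At the places that
contain `t` the polynomial reduces to `X² - X + n` and the residue extension is nontrivial; at the
places that contain `1 - t` it is an Eisenstein polynomial and `ℓ` ramifies. -/
theorem exists_sub_intCast_notMem_or_natCast_mem_sq {K : Type*} [Field K] [NumberField K] {n : ℤ}
    (hn : ∀ r : ℤ, ¬ (ℓ : ℤ) ∣ r ^ 2 - r + n) {t b : K} (ht : t ^ 2 - t + ℓ = 0)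
    (hb : b ^ 2 - (1 - t) * b + (1 - t) * n = 0) (φ : K →+* PadicAlgCl ℓ) :
    (‖φ t‖ < 1 → ∃ a : 𝓞 K, ∀ m : ℤ, a - m ∉ adicPrime φ) ∧
      (‖φ (1 - t)‖ < 1 → (ℓ : 𝓞 K) ∈ adicPrime φ ^ 2) ∧ (‖φ t‖ < 1 ∨ ‖φ (1 - t)‖ < 1) := by
  have htint : IsIntegral ℤ t := isIntegral_of_sq_sub_self (c := ℓ) (by exact_mod_cast ht)
  have ht1 : IsIntegral ℤ (1 - t) := isIntegral_one.sub htint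
  have hbint : IsIntegral ℤ b := isIntegral_of_quadratic ht1 (ht1.mul (isIntegral_intCast n)) hb
  obtain ⟨t, rfl⟩ : ∃ t' : 𝓞 K, (t' : K) = t := ⟨⟨t, htint⟩, rfl⟩
  obtain ⟨b, rfl⟩ : ∃ b' : 𝓞 K, (b' : K) = b := ⟨⟨b, hbint⟩, rfl⟩
  refine ⟨fun h ↦ exists_sub_intCast_notMem_of_norm_lt hn φ hbint ?_, fun h ↦ ?_, ?_⟩
  · have hb' := congrArg φ hb
    simp only [map_add, map_sub, map_mul, map_pow, map_one, map_intCast, map_zero] at hb'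
    have hle : ‖φ (n - b : K)‖ ≤ 1 := PadicAlgCl.norm_le_one_of_isIntegral
      (map_isIntegral_int φ ((isIntegral_intCast n).sub hbint))
    have := PadicAlgCl.norm_mul_lt_one h hle
    rw [show φ (b : K) ^ 2 - φ b + n = φ t * φ (n - b : K) by
      rw [map_sub, map_intCast]
      linear_combination hb']
    exact this
  · refine natCast_mem_adicPrime_sq_of_eisenstein (n := n) (t := t) (b := b)
      (by simpa using hn 0) φ ?_ ?_ (by rw [mem_adicPrime]; simpa using h)
    · exact NumberField.RingOfIntegers.coe_injective (by simpa using ht)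
    · exact NumberField.RingOfIntegers.coe_injective (by simpa using hb)
  · by_contra! hc
    have h1 : ‖φ ((t : K) * (1 - t))‖ < 1 := by
      rw [show (t : K) * (1 - t) = ℓ by linear_combination -ht, map_natCast]
      exact PadicAlgCl.norm_natCast_prime_lt_one
    rw [map_mul, norm_mul] at h1
    exact absurd h1 (not_lt.2 (one_le_mul_of_one_le_of_one_le hc.1 hc.2))

variable {Qbar : Type*} [Field Qbar] [CharZero Qbar] {ι : Qbar →+* AlgebraicClosure ℚ_[ℓ]}
theorem isTotallyAdic_adjoin_of_quadratic {θ : Qbar} (hθ : θ ^ 2 - θ + ℓ = 0) :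
    IsTotallyAdic ι (IntermediateField.adjoin ℚ {θ}) := by
  rw [isTotallyAdic_iff_le, IntermediateField.adjoin_simple_le_iff]
  exact mem_totallyAdicSubfield_of_quadratic hθ

variable [IsAlgClosure ℚ Qbar] {n : ℤ} {ω θ β : Qbar}

theorem hasAdicConjugation_adjoin_unramified (hn : ∀ r : ℤ, ¬ (ℓ : ℤ) ∣ r ^ 2 - r + n)
    (hω : ω ^ 2 - ω + n = 0) [NumberField (IntermediateField.adjoin ℚ {ω})] :
    HasAdicConjugation ι (IntermediateField.adjoin ℚ {ω}) := by
  have hF : IsTotallyAdic ι (⊥ : IntermediateField ℚ Qbar) := isTotallyAdic_iff_le.2 bot_le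
  have h : (⊥ : IntermediateField ℚ Qbar) ≤ IntermediateField.adjoin ℚ {ω} := bot_le
  have := IntermediateField.numberField_of_le h
  have := IntermediateField.numberField_extendScalars h
  refine ⟨⊥, h, hF, hF.allEmbeddingsAdic.isNonsplitAbove ?_ fun L hL ↦ Or.inl ?_⟩
  · exact IntermediateField.finrank_extendScalars_le_two h (b := 1) (c := n) le_sup_right
      (one_mem _) (intCast_mem _ n) (by rwa [one_mul])
  · obtain ⟨φ, rfl⟩ := exists_adicPrime_eq hL
    let w : IntermediateField.extendScalars h := ⟨ω, IntermediateField.mem_adjoin_simple_self ℚ ω⟩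
    have hw : w ^ 2 - w + n = 0 := Subtype.ext hω
    refine exists_sub_intCast_notMem_of_norm_lt hn φ (w := w) (isIntegral_of_sq_sub_self hw) ?_
    have := congrArg φ hw
    simp only [map_add, map_sub, map_pow, map_intCast, map_zero] at this
    rw [this, norm_zero]
    exact one_pos

theorem hasAdicConjugation_adjoin_mixed (hn : ∀ r : ℤ, ¬ (ℓ : ℤ) ∣ r ^ 2 - r + n)
    (hθ : θ ^ 2 - θ + ℓ = 0) (hβ : β ^ 2 - (1 - θ) * β + (1 - θ) * n = 0)
    [NumberField ↥(IntermediateField.adjoin ℚ {θ} ⊔ IntermediateField.adjoin ℚ {β})] :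
    HasAdicConjugation ι (IntermediateField.adjoin ℚ {θ} ⊔ IntermediateField.adjoin ℚ {β}) := by
  have hF := isTotallyAdic_adjoin_of_quadratic (ι := ι) hθ
  have h : IntermediateField.adjoin ℚ {θ} ≤
    IntermediateField.adjoin ℚ {θ} ⊔ IntermediateField.adjoin ℚ {β} := le_sup_left
  have hθE := IntermediateField.mem_adjoin_simple_self ℚ θ
  have hβE : β ∈ IntermediateField.adjoin ℚ {θ} ⊔ IntermediateField.adjoin ℚ {β} :=
    (le_sup_right : IntermediateField.adjoin ℚ {β} ≤ _)
      (IntermediateField.mem_adjoin_simple_self ℚ β)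
  have := IntermediateField.numberField_of_le h
  have := IntermediateField.numberField_extendScalars h
  refine ⟨_, h, hF, hF.allEmbeddingsAdic.isNonsplitAbove ?_ fun L hL ↦ ?_⟩
  · exact IntermediateField.finrank_extendScalars_le_two h le_rfl
      (sub_mem (one_mem _) hθE) (mul_mem (sub_mem (one_mem _) hθE) (intCast_mem _ n)) hβ
  · obtain ⟨φ, rfl⟩ := exists_adicPrime_eq hL
    let t : IntermediateField.extendScalars h := ⟨θ, h hθE⟩
    let b : IntermediateField.extendScalars h := ⟨β, hβE⟩
    obtain ⟨h1, h2, h3⟩ := exists_sub_intCast_notMem_or_natCast_mem_sq hn (t := t) (b := b)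
      (Subtype.ext hθ) (Subtype.ext hβ) φ
    exact h3.imp h1 h2

/-- The conjugates of a nonrational root of `X² - X + ℓ` include one that `ι` maps into the maximal
ideal, and one that it maps to a unit. -/
theorem exists_norm_lt_one_of_quadratic (hθ : θ ^ 2 - θ + ℓ = 0) :
    (∃ σ : Qbar ≃ₐ[ℚ] Qbar, ‖(ι (σ θ) : PadicAlgCl ℓ)‖ < 1) ∧
      ∃ σ : Qbar ≃ₐ[ℚ] Qbar, ‖(ι (σ (1 - θ)) : PadicAlgCl ℓ)‖ < 1 := by
  -- As `θ` is irrational, some `σ` swaps `θ` and `1 - θ`. Their product is `ℓ`, so `ι` makes one of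
  -- them small and `σ` exchanges the two cases.
  obtain ⟨σ, -, hσ⟩ := exists_algEquiv_eq_sub_self (x := θ) (b := 1) (c := (ℓ : Qbar)) (one_mem _)
    (natCast_mem _ ℓ)
    (by rwa [one_mul]) (notMem_bot_of_quadratic (Fact.out : ℓ.Prime).ne_zero hθ)
  have hσ' : σ (1 - θ) = θ := by rw [map_sub, map_one, hσ, sub_sub_cancel]
  have h : ‖(ι θ : PadicAlgCl ℓ)‖ < 1 ∨ ‖(ι (1 - θ) : PadicAlgCl ℓ)‖ < 1 := by
    by_contra! hc
    have h1 : ‖(ι (θ * (1 - θ)) : PadicAlgCl ℓ)‖ < 1 := by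
      rw [show θ * (1 - θ) = ℓ by linear_combination -hθ, map_natCast]
      exact PadicAlgCl.norm_natCast_prime_lt_one
    rw [map_mul, norm_mul] at h1
    exact absurd h1 (not_lt.2 (one_le_mul_of_one_le_of_one_le hc.1 hc.2))
  rcases h with h | h
  · exact ⟨⟨AlgEquiv.refl, h⟩, σ, by rwa [hσ']⟩
  · exact ⟨⟨σ, by rwa [hσ]⟩, AlgEquiv.refl, h⟩

end

/-! ### Failure of `ℓ`-adic conjugation for the compositum -/

section

variable {ℓ : ℕ} [Fact ℓ.Prime]
variable {Qbar : Type*} [Field Qbar] [CharZero Qbar] {ι : Qbar →+* AlgebraicClosure ℚ_[ℓ]}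
/-- If `F` is non-split in `B` above `ℓ`, then the place of `B` defined by an embedding depends only
on the restriction of the embedding to `F`. -/
theorem IsNonsplitAbove.norm_lt_one_of_norm_lt_one {F B : IntermediateField ℚ Qbar} {h : F ≤ B}
    (hns : IsNonsplitAbove ℓ F (IntermediateField.extendScalars h)) (φ : Qbar →+* PadicAlgCl ℓ)
    {σ : Qbar ≃ₐ[ℚ] Qbar} (hσ : ∀ y ∈ F, σ y = y) {x : Qbar} (hxB : x ∈ B) (hint : IsIntegral ℤ x) :
    ‖φ x‖ < 1 ↔ ‖φ (σ x)‖ < 1 := by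
  let ψ : IntermediateField.extendScalars h →+* PadicAlgCl ℓ := φ.comp (algebraMap _ Qbar)
  let ψ' : IntermediateField.extendScalars h →+* PadicAlgCl ℓ :=
    (φ.comp (σ : Qbar →+* Qbar)).comp (algebraMap _ Qbar)
  have hres : ψ.comp (algebraMap F _) = ψ'.comp (algebraMap F _) :=
    RingHom.ext fun y ↦ congrArg φ (hσ y y.2).symm
  have heq : adicPrime ψ = adicPrime ψ' := by
    refine (hns _ (adicPrime_mem_placesAbove (ψ.comp (algebraMap F _)))).unique
      (adicPrime_mem_primesOver ψ) ?_
    rw [hres]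
    exact adicPrime_mem_primesOver ψ'
  have hint' : IsIntegral ℤ (⟨x, hxB⟩ : IntermediateField.extendScalars h) := by
    rwa [← isIntegral_algebraMap_iff
      (algebraMap (IntermediateField.extendScalars h) Qbar).injective]
  let y : 𝓞 (IntermediateField.extendScalars h) := ⟨⟨x, hxB⟩, hint'⟩
  exact (iff_of_eq (congrArg (y ∈ ·) heq) : y ∈ adicPrime ψ ↔ y ∈ adicPrime ψ')

variable [IsAlgClosure ℚ Qbar] {n : ℤ} {ω θ β : Qbar}

/-- At an embedding making `1 - θ` small, `ω` forces `f ≥ 2` and `β` forces `e ≥ 2`. -/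
theorem four_le_finrank_of_mixed (hn : ∀ r : ℤ, ¬ (ℓ : ℤ) ∣ r ^ 2 - r + n)
    (hω : ω ^ 2 - ω + n = 0) (hθ : θ ^ 2 - θ + ℓ = 0)
    (hβ : β ^ 2 - (1 - θ) * β + (1 - θ) * n = 0) {F B : IntermediateField ℚ Qbar} [NumberField B]
    (h : F ≤ B) (hF : IsTotallyAdic ι F) (hωB : ω ∈ B) (hθB : θ ∈ B) (hβB : β ∈ B) :
    4 ≤ Module.finrank F (IntermediateField.extendScalars h) := by
  have := IntermediateField.numberField_of_le h
  have := IntermediateField.numberField_extendScalars h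
  obtain ⟨-, σ, hσ⟩ := exists_norm_lt_one_of_quadratic (ι := ι) hθ
  let φ : IntermediateField.extendScalars h →+* PadicAlgCl ℓ :=
    (ι.comp (σ : Qbar →+* Qbar)).comp (algebraMap _ Qbar)
  let w : IntermediateField.extendScalars h := ⟨ω, hωB⟩
  have hw : w ^ 2 - w + n = 0 := Subtype.ext hω
  let t : IntermediateField.extendScalars h := ⟨θ, hθB⟩
  let b : IntermediateField.extendScalars h := ⟨β, hβB⟩
  obtain ⟨-, h2, -⟩ := exists_sub_intCast_notMem_or_natCast_mem_sq hn (t := t) (b := b)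
      (Subtype.ext hθ) (Subtype.ext hβ) φ
  refine hF.allEmbeddingsAdic.four_le_finrank φ
    (exists_sub_intCast_notMem_of_norm_lt hn φ (w := w) (isIntegral_of_sq_sub_self hw) ?_) (h2 hσ)
  have := congrArg φ hw
  simp only [map_add, map_sub, map_pow, map_intCast, map_zero] at this
  rw [this, norm_zero]
  exact one_pos

theorem not_hasAdicConjugation_sup (hn : ∀ r : ℤ, ¬ (ℓ : ℤ) ∣ r ^ 2 - r + n)
    (hω : ω ^ 2 - ω + n = 0) (hθ : θ ^ 2 - θ + ℓ = 0)
    (hβ : β ^ 2 - (1 - θ) * β + (1 - θ) * n = 0)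
    [NumberField ↥(IntermediateField.adjoin ℚ {ω} ⊔
      (IntermediateField.adjoin ℚ {θ} ⊔ IntermediateField.adjoin ℚ {β}))] :
    ¬ HasAdicConjugation ι (IntermediateField.adjoin ℚ {ω} ⊔
      (IntermediateField.adjoin ℚ {θ} ⊔ IntermediateField.adjoin ℚ {β})) := by
  rintro ⟨F, h, hF, hns⟩
  set B := IntermediateField.adjoin ℚ {ω} ⊔
      (IntermediateField.adjoin ℚ {θ} ⊔ IntermediateField.adjoin ℚ {β}) with hB
  have hωle : IntermediateField.adjoin ℚ {ω} ≤ B := le_sup_left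
  have hθle : IntermediateField.adjoin ℚ {θ} ≤ B := le_sup_left.trans le_sup_right
  have hβle : IntermediateField.adjoin ℚ {β} ≤ B := le_sup_right.trans le_sup_right
  have hωB := hωle (IntermediateField.mem_adjoin_simple_self ℚ ω)
  have hθB := hθle (IntermediateField.mem_adjoin_simple_self ℚ θ)
  have hβB := hβle (IntermediateField.mem_adjoin_simple_self ℚ β)
  -- Adjoining `θ` keeps the base totally `ℓ`-adic and makes `β` quadratic over it; non-splitness is
  -- used only over `F`.
  let E := F ⊔ IntermediateField.adjoin ℚ {θ}
  have hE : IsTotallyAdic ι E := hF.sup (isTotallyAdic_adjoin_of_quadratic hθ)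
  have hEB : E ≤ B := sup_le h hθle
  have hθE : θ ∈ E := (le_sup_right : IntermediateField.adjoin ℚ {θ} ≤ E)
    (IntermediateField.mem_adjoin_simple_self ℚ θ)
  let M := E ⊔ IntermediateField.adjoin ℚ {β}
  have hβM : β ∈ M := (le_sup_right : IntermediateField.adjoin ℚ {β} ≤ M)
    (IntermediateField.mem_adjoin_simple_self ℚ β)
  have hEM : E ≤ M := le_sup_left
  -- Otherwise `B = E(β)` would have degree at most 2 over `E`.
  have hωM : ω ∉ M := by
    intro hωM
    have hBM : B ≤ M := by
      refine sup_le ?_ (sup_le (le_sup_right.trans hEM) le_sup_right)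
      rwa [IntermediateField.adjoin_simple_le_iff]
    have h4 := four_le_finrank_of_mixed hn hω hθ hβ hEB hE hωB hθB hβB
    have h2 := IntermediateField.finrank_extendScalars_le_two hEB hBM
      (sub_mem (one_mem _) hθE) (mul_mem (sub_mem (one_mem _) hθE) (intCast_mem _ n)) hβ
    omega
  obtain ⟨σ, hσM, hσω⟩ := exists_algEquiv_eq_sub_self (x := ω) (b := 1) (c := (n : Qbar))
    (one_mem M) (intCast_mem _ n) (by rwa [one_mul]) hωM
  obtain ⟨⟨τ, hτ⟩, -⟩ := exists_norm_lt_one_of_quadratic (ι := ι) hθ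
  let φ : Qbar →+* PadicAlgCl ℓ := ι.comp (τ : Qbar →+* Qbar)
  have hθint : IsIntegral ℤ θ := isIntegral_of_sq_sub_self (c := ℓ) (by exact_mod_cast hθ)
  have hωint : IsIntegral ℤ ω := isIntegral_of_sq_sub_self hω
  have hβint : IsIntegral ℤ β := isIntegral_of_quadratic (isIntegral_one.sub hθint)
    ((isIntegral_one.sub hθint).mul (isIntegral_intCast n)) hβ
  have hiff := hns.norm_lt_one_of_norm_lt_one φ (σ := σ)
    (fun y hy ↦ hσM y (hEM ((le_sup_left : F ≤ E) hy))) (sub_mem hβB hωB) (hβint.sub hωint)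
  rw [map_sub σ, hσM β hβM, hσω] at hiff
  -- With `θ` small, `β` is congruent to `ω` or to `1 - ω`. Since `σ` exchanges these differences
  -- and non-splitness makes them small together, both are small, hence so is `2ω - 1` up to sign,
  -- whose square `1 - 4n` is prime to `ℓ`.
  have hprod : ‖φ (β - ω)‖ * ‖φ (β - (1 - ω))‖ < 1 := by
    rw [← norm_mul, ← map_mul,
      show (β - ω) * (β - (1 - ω)) = θ * (n - β) by linear_combination hβ - hω, map_mul]
    exact PadicAlgCl.norm_mul_lt_one hτ (PadicAlgCl.norm_le_one_of_isIntegral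
      (map_isIntegral_int φ ((isIntegral_intCast n).sub hβint)))
  have h1 : ‖φ (β - ω)‖ < 1 := by
    by_contra hc
    exact absurd hprod (not_lt.2 (one_le_mul_of_one_le_of_one_le (not_lt.1 hc)
      (not_lt.1 fun h ↦ hc (hiff.2 h))))
  have h2 := PadicAlgCl.norm_sub_lt_one h1 (hiff.1 h1)
  have h3 := PadicAlgCl.norm_mul_lt_one h2 h2.le
  rw [← map_sub, ← map_mul, show (β - ω - (β - (1 - ω))) * (β - ω - (β - (1 - ω))) =
    ((1 - 4 * n : ℤ) : Qbar) by push_cast; linear_combination 4 * hω, map_intCast,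
    PadicAlgCl.norm_intCast_lt_one_iff] at h3
  exact not_dvd_one_sub_four_mul hn h3

theorem exists_hasAdicConjugation_not_sup :
    ∃ K K' : IntermediateField ℚ Qbar, NumberField K ∧ NumberField K' ∧
      HasAdicConjugation ι K ∧ HasAdicConjugation ι K' ∧ ¬ HasAdicConjugation ι (K ⊔ K') := by
  have := IsAlgClosure.isAlgClosed (R := ℚ) (K := Qbar)
  have := IsAlgClosure.isAlgebraic (R := ℚ) (K := Qbar)
  obtain ⟨n, hn⟩ := exists_int_forall_not_dvd_quadratic ℓ
  obtain ⟨ω, hω⟩ := IsAlgClosed.exists_quadratic_root (1 : Qbar) n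
  obtain ⟨θ, hθ⟩ := IsAlgClosed.exists_quadratic_root (1 : Qbar) ℓ
  obtain ⟨β, hβ⟩ := IsAlgClosed.exists_quadratic_root (1 - θ) ((1 - θ) * n)
  rw [one_mul] at hω hθ
  have hfin : ∀ x : Qbar, FiniteDimensional ℚ (IntermediateField.adjoin ℚ {x}) := fun x ↦
    IntermediateField.adjoin.finiteDimensional (Algebra.IsIntegral.isIntegral x)
  have := hfin ω
  have := hfin θ
  have := hfin β
  have h1 : NumberField (IntermediateField.adjoin ℚ {ω}) := { }
  have h2 : NumberField ↥(IntermediateField.adjoin ℚ {θ} ⊔ IntermediateField.adjoin ℚ {β}) :=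
    { to_finiteDimensional := IntermediateField.finiteDimensional_sup _ _ }
  have h3 : NumberField ↥(IntermediateField.adjoin ℚ {ω} ⊔
      (IntermediateField.adjoin ℚ {θ} ⊔ IntermediateField.adjoin ℚ {β})) :=
    { to_finiteDimensional := IntermediateField.finiteDimensional_sup _ _ }
  exact ⟨_, _, h1, h2, hasAdicConjugation_adjoin_unramified hn hω,
    hasAdicConjugation_adjoin_mixed hn hθ hβ, not_hasAdicConjugation_sup hn hω hθ hβ⟩

end

theorem proposition11 (ℓ : ℕ) [Fact ℓ.Prime]
    (Qbar : Type*) [Field Qbar] [CharZero Qbar] [IsAlgClosure ℚ Qbar]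
    (ι : Qbar →+* AlgebraicClosure ℚ_[ℓ]) :
    (∀ K K' : IntermediateField ℚ Qbar, NumberField K → NumberField K' →
      IsTotallyAdic ι K → IsTotallyAdic ι K' → IsTotallyAdic ι (K ⊔ K')) ∧
    (∃ K K' : IntermediateField ℚ Qbar, NumberField K ∧ NumberField K' ∧
      HasAdicConjugation ι K ∧ HasAdicConjugation ι K' ∧ ¬ HasAdicConjugation ι (K ⊔ K')) ∧
    (∀ K K' : IntermediateField ℚ Qbar, NumberField K → NumberField K' →
      HasUnramifiedQuadraticAdicConjugation ι K → HasUnramifiedQuadraticAdicConjugation ι K' →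
        HasUnramifiedQuadraticAdicConjugation ι (K ⊔ K')) :=
  ⟨fun _ _ _ _ h h' ↦ h.sup h', exists_hasAdicConjugation_not_sup,
    fun _ _ _ _ h h' ↦ h.sup h'⟩
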